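/- **Setting.** Let $M_1,\dots,M_n$ be smooth, Hausdorff, second-countable $d$-manifolds without boundary. An adjunction system consists of open sets $M_{ij}\subseteq M_i$ and smooth maps $f_{ij}:M_{ij}\to M_j$ such that: $M_{ii}=M_i$ and $f_{ii}=\mathrm{id}$; $f_{ij}(M_{ij})=M_{ji}$ and $f_{ij}^{-1}=f_{ji}$; and for $x\in M_{ij}\cap M_{ik}$ one has $f_{ij}(x)\in M_{jk}$ and $f_{ik}(x)=f_{jk}(f_{ij}(x))$. Assume that each closure $\mathrm{cl}_{M_i}(M_{ij})$ is a regular domain of $M_i$ (a closed subset that is an embedded codimension-$0$ submanifold with boundary), and that the $f_{ij}$ extend to diffeomorphisms $\overline{f_{ij}}:\mathrm{cl}_{M_i}(M_{ij})\to \mathrm{cl}_{M_j}(M_{ji})$ which satisfy the same conditions as the $f_{ij}$. Let $\mathbf M=\bigsqcup_i M_i/{\sim}$, where $(x,i)\sim(y,j)$ iff $x\in M_{ij}$ and $f_{ij}(x)=y$, with the canonical open embeddings $\varphi_i:M_i\to\mathbf M$ and the smooth atlas consisting of the charts of the $M_i$ transported by the $\varphi_i$; $\mathbf M$ is a smooth,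 in general non-Hausdorff, manifold. Assume that each $M_i$ is oriented by an atlas of smooth charts whose transition maps have positive Jacobian, and that the $f_{ij}$ preserve orientation; give $\mathbf M$ the induced orientation. For $i_1<\dots<i_p$ write $M_{i_1\cdots i_p}=\varphi_{i_1}(M_{i_1})\cap\dots\cap \varphi_{i_p}(M_{i_p})$, also viewed as an open subset of each $M_{i_k}$. **Integrals.** Let $X$ be $\mathbf M$ or one of the $M_i$, let $K\subseteq X$, and let $\eta$ be a $d$-form on $X$. A parametrisation of $K$ for $\eta$ is a finite family of bounded open sets $A_\alpha\subset\mathbb R^d$ with $\partial A_\alpha$ of measure zero, and maps $a_\alpha:\overline{A_\alpha}\to X$ that are smooth (i.e. locally extend to smooth maps on open sets) and restrict to orientation-preserving diffeomorphisms from $A_\alpha$ onto pairwise disjoint open subsets $U_\alpha$ of $X$ with $U_\alpha\subseteq K$, such that $\overline{\{x\in K:\eta(x)\ne0\}}\subseteq\bigcup_\alpha\overline{U_\alpha}$. One sets $\int_K\eta=\sum_\alpha\int_{A_\alpha}a_\alpha^*\eta$. **Theorem.** Let $\omega$ be a smooth compactly supported $d$-form on $\mathbf M$. Then $\int_{\mathbf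 M}\omega$, all $\int_{M_i}\varphi_i^*\omega$, and all $\int_{\mathrm{cl}_{M_i}(M_{i_1\cdots i_p})}\varphi_i^*\omega$ with $i\in\{i_1,\dots,i_p\}$ are well defined (parametrisations exist, and the value does not depend on the choice), and $$\int_{\mathbf M}\omega=\sum_{i=1}^n\int_{M_i}\varphi_i^*\omega-\sum_{p=2}^n(-1)^p\sum_{i_1<\dots<i_p}\int_{\mathrm{cl}_{M_{i_1}}(M_{i_1\cdots i_p})}\varphi_{i_1}^*\omega .$$ In particular, for $n=2$ and $\{i,j\}=\{1,2\}$, $$\int_{\mathbf M}\omega=\int_{M_i}\varphi_i^*\omega+\int_{M_j}\varphi_j^*\omega-\int_{\mathrm{cl}_{M_i}(M_{ij})}\varphi_i^*\omega .$$ -/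

import Mathlib

open Set Topology MeasureTheory
open scoped Manifold ContDiff

/-! ## Smooth manifolds, forms, orientations and integration over parametrisations

A `d`-dimensional smooth manifold, Hausdorff or not, is a charted space over
`Euc d` all of whose transition maps are smooth. -/

/-- Euclidean `d`-space. -/
abbrev Euc (d : ℕ) : Type := EuclideanSpace ℝ (Fin d)

/-- A (not necessarily continuous) form of top degree on a `d`-dimensional manifold `X`:
an alternating `d`-linear form on each tangent space. -/
abbrev TopForm (d : ℕ) (X : Type*) [TopologicalSpace X] [ChartedSpace (Euc d) X] : Type _ :=
  ∀ x : X, (TangentSpace 𝓘(ℝ, Euc d) x) [⋀^Fin d]→L[ℝ] ℝ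

section Manifold

variable {d : ℕ} {X Y : Type*} [TopologicalSpace X] [ChartedSpace (Euc d) X]
  [TopologicalSpace Y] [ChartedSpace (Euc d) Y]

/-- The pullback `g^* η`. -/
noncomputable def TopForm.pullback (g : X → Y) (η : TopForm d Y) : TopForm d X :=
  fun x => (η (g x)).compContinuousLinearMap (mfderiv 𝓘(ℝ, Euc d) 𝓘(ℝ, Euc d) g x)

/-- The expression of `η` in the coordinates given by `g`, as a map to a fixed vector space. -/
noncomputable def TopForm.inCoords (g : Euc d → X) (η : TopForm d X) (y : Euc d) :
    (Euc d) [⋀^Fin d]→L[ℝ] ℝ :=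
  TopForm.pullback g η y

/-- `η` is a smooth differential form: its expression in charts is smooth. -/
def TopForm.IsSmooth (η : TopForm d X) : Prop :=
  ∀ x : X, ContDiffOn ℝ ∞ (TopForm.inCoords (chartAt (Euc d) x).symm η) (chartAt (Euc d) x).target

/-- The support of the restriction of `η` to `K` (for `K = univ`, the support of `η`). -/
def TopForm.supportOn (η : TopForm d X) (K : Set X) : Set X :=
  closure {x | x ∈ K ∧ η x ≠ 0}

/-- The integral over `A ⊆ ℝ^d` of a form `η = h dx¹ ∧ ⋯ ∧ dx^d`, that is `∫_A h`. -/
noncomputable def TopForm.euclideanIntegral (A : Set (Euc d)) (η : TopForm d (Euc d)) : ℝ :=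
  ∫ y in A, η y (fun k => EuclideanSpace.basisFun (Fin d) ℝ k)

/-- Smoothness of a map on an arbitrary subset: near each point of `s`, the map agrees on `s`
with a smooth map that is defined on an open neighbourhood of the point. -/
def SmoothOnSet (d : ℕ) {X Y : Type*} [TopologicalSpace X] [ChartedSpace (Euc d) X]
    [TopologicalSpace Y] [ChartedSpace (Euc d) Y] (g : X → Y) (s : Set X) : Prop :=
  ∀ x ∈ s, ∃ (V : Set X) (h : X → Y), IsOpen V ∧ x ∈ V ∧
    ContMDiffOn 𝓘(ℝ, Euc d) 𝓘(ℝ, Euc d) ∞ h V ∧ EqOn h g (s ∩ V)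

/-- On `s`, the map `g` has positive Jacobian determinant in the given charts. -/
def PreservesOrientationOn (𝒪 : Set (OpenPartialHomeomorph X (Euc d)))
    (𝒪' : Set (OpenPartialHomeomorph Y (Euc d))) (g : X → Y) (s : Set X) : Prop :=
  ∀ x ∈ s, ∀ e ∈ 𝒪, x ∈ e.source → ∀ e' ∈ 𝒪', g x ∈ e'.source →
    0 < (fderiv ℝ (fun y : Euc d => e' (g (e.symm y))) (e x)).det

/-- An oriented atlas: smooth charts that cover `X` and whose transition maps have positive
Jacobian determinant. An orientation of `X` is given by such an atlas; its members are the
positively oriented charts. -/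
structure IsOrientedAtlas (𝒪 : Set (OpenPartialHomeomorph X (Euc d))) : Prop where
  subset : 𝒪 ⊆ IsManifold.maximalAtlas 𝓘(ℝ, Euc d) ∞ X
  cover : ∀ x : X, ∃ e ∈ 𝒪, x ∈ e.source
  compat : PreservesOrientationOn 𝒪 𝒪 (id : X → X) univ

/-- A regular domain of a manifold without boundary: a closed subset which is an embedded
codimension-0 submanifold with boundary, i.e. which around each of its frontier points is a
half-space in a suitable smooth chart. -/
structure IsRegularDomain (d : ℕ) {X : Type*} [TopologicalSpace X] [ChartedSpace (Euc d) X]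
    (D : Set X) : Prop where
  isClosed : IsClosed D
  halfSpace : ∀ p ∈ frontier D, ∃ e ∈ IsManifold.maximalAtlas 𝓘(ℝ, Euc d) ∞ X,
    p ∈ e.source ∧ ∃ k : Fin d, ∀ q ∈ e.source, (q ∈ D ↔ 0 ≤ e q k)

/-- A parametrisation of the subset `K` of `X` (typically `K = X`, or `K` closed) that is
adapted to the form `η`: finitely many open domains of integration `A α ⊆ ℝ^d`, i.e. bounded
open sets with frontier of measure zero, and maps `a α : closure (A α) → X`, smooth on
`closure (A α)`, which restrict to orientation-preserving diffeomorphisms from `A α` onto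
pairwise disjoint open subsets `U α` of `X`, contained in `K`, whose closures cover the support
of `η` on `K`. Values of `a α` outside `closure (A α)` play no role. -/
structure Parametrisation (𝒪 : Set (OpenPartialHomeomorph X (Euc d))) (K : Set X)
    (η : TopForm d X) where
  num : ℕ
  A : Fin num → Set (Euc d)
  a : Fin num → Euc d → X
  isOpen_dom : ∀ α, IsOpen (A α)
  isBounded_dom : ∀ α, Bornology.IsBounded (A α)
  null_frontier : ∀ α, volume (frontier (A α)) = 0
  smooth : ∀ α, SmoothOnSet d (a α) (closure (A α))
  isOpen_image : ∀ α, IsOpen (a α '' A α)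
  smooth_inv : ∀ α, ∃ b : X → Euc d, ContMDiffOn 𝓘(ℝ, Euc d) 𝓘(ℝ, Euc d) ∞ b (a α '' A α) ∧
    ∀ y ∈ A α, b (a α y) = y
  orientation : ∀ α, PreservesOrientationOn {OpenPartialHomeomorph.refl (Euc d)} 𝒪 (a α) (A α)
  image_subset : ∀ α, a α '' A α ⊆ K
  disjoint : ∀ α β, α ≠ β → Disjoint (a α '' A α) (a β '' A β)
  cover : η.supportOn K ⊆ ⋃ α, closure (a α '' A α)

/-- The sum `∑_α ∫_{A α} (a α)^* η`. -/
noncomputable def Parametrisation.value {𝒪 : Set (OpenPartialHomeomorph X (Euc d))} {K : Set X}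
    {η : TopForm d X} (P : Parametrisation 𝒪 K η) : ℝ :=
  ∑ α, TopForm.euclideanIntegral (P.A α) (TopForm.pullback (P.a α) η)

open Classical in
/-- The integral of `η` over `K ⊆ X`, where `X` is oriented by `𝒪`: the value of any
parametrisation of `K`. It is meaningful when `IntegralWellDefined 𝒪 K η` holds. -/
noncomputable def formIntegral (𝒪 : Set (OpenPartialHomeomorph X (Euc d))) (K : Set X)
    (η : TopForm d X) : ℝ :=
  if h : Nonempty (Parametrisation 𝒪 K η) then (Classical.choice h).value else 0

/-- Parametrisations of `K` adapted to `η` exist, and they all give the same value. -/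
def IntegralWellDefined (𝒪 : Set (OpenPartialHomeomorph X (Euc d))) (K : Set X)
    (η : TopForm d X) : Prop :=
  Nonempty (Parametrisation 𝒪 K η) ∧ ∀ P : Parametrisation 𝒪 K η, P.value = formIntegral 𝒪 K η

end Manifold

/-! ## Adjunction systems and their colimits -/

/-- An adjunction system of smooth `d`-manifolds `M i`, `i ∈ Fin n`: open gluing regions
`U i j ⊆ M i` and smooth gluing maps `f i j : U i j → M j` (values of `f i j` outside `U i j`
play no role). The conditions make `f i j` a diffeomorphism from `U i j` onto `U j i`, hence
an open embedding into `M j`. -/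
structure AdjunctionSystem (d n : ℕ) (M : Fin n → Type*) [∀ i, TopologicalSpace (M i)]
    [∀ i, ChartedSpace (Euc d) (M i)] where
  U : ∀ i, Fin n → Set (M i)
  f : ∀ i j, M i → M j
  isOpen_U : ∀ i j, IsOpen (U i j)
  smooth_f : ∀ i j, ContMDiffOn 𝓘(ℝ, Euc d) 𝓘(ℝ, Euc d) ∞ (f i j) (U i j)
  U_self : ∀ i, U i i = univ
  f_self : ∀ i x, f i i x = x
  mapsTo : ∀ i j, MapsTo (f i j) (U i j) (U j i)
  left_inv : ∀ i j, ∀ x ∈ U i j, f j i (f i j x) = x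
  cocycle_mem : ∀ i j k x, x ∈ U i j → x ∈ U i k → f i j x ∈ U j k
  cocycle : ∀ i j k x, x ∈ U i j → x ∈ U i k → f j k (f i j x) = f i k x

namespace AdjunctionSystem

variable {d n : ℕ} {M : Fin n → Type*} [∀ i, TopologicalSpace (M i)]
    [∀ i, ChartedSpace (Euc d) (M i)] (G : AdjunctionSystem d n M)

/-- The gluing relation: `(x, i) ∼ (y, j)` when `x ∈ U i j` and `f i j x = y`. -/
def setoid : Setoid (Σ i, M i) where
  r p q := p.2 ∈ G.U p.1 q.1 ∧ G.f p.1 q.1 p.2 = q.2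
  iseqv :=
    { refl := fun p => ⟨by simp [G.U_self], G.f_self _ _⟩
      symm := by
        rintro ⟨i, x⟩ ⟨j, y⟩ ⟨h, hy⟩
        simp only at h hy
        subst hy
        exact ⟨G.mapsTo _ _ h, G.left_inv _ _ _ h⟩
      trans := by
        rintro ⟨i, x⟩ ⟨j, y⟩ ⟨k, z⟩ ⟨h, hy⟩ ⟨h', hz⟩
        simp only at h hy h' hz
        subst hy
        subst hz
        have h1 := G.mapsTo _ _ h
        have e1 := G.left_inv _ _ _ h
        have h2 := G.cocycle_mem _ _ _ _ h1 h'
        have e2 := G.cocycle _ _ _ _ h1 h'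
        rw [e1] at h2 e2
        exact ⟨h2, e2⟩ }

/-- The colimit of the system: the quotient of the disjoint union of the `M i` by the gluing
relation. -/
def Colimit : Type _ := Quotient G.setoid

instance : TopologicalSpace G.Colimit := inferInstanceAs (TopologicalSpace (Quotient G.setoid))

/-- The canonical map `φ i : M i → 𝐌`. -/
def φ (i : Fin n) (x : M i) : G.Colimit := Quotient.mk G.setoid ⟨i, x⟩

theorem φ_eq_iff {i j : Fin n} {x : M i} {y : M j} :
    G.φ i x = G.φ j y ↔ x ∈ G.U i j ∧ G.f i j x = y :=
  Quotient.eq (r := G.setoid)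

theorem isOpen_iff (W : Set G.Colimit) : IsOpen W ↔ ∀ i, IsOpen (G.φ i ⁻¹' W) := by
  have h := (isQuotientMap_quotient_mk' (s := G.setoid)).isOpen_preimage (s := W)
  exact h.symm.trans isOpen_sigma_iff

theorem isOpenEmbedding_φ (i : Fin n) : IsOpenEmbedding (G.φ i) := by
  refine .of_continuous_injective_isOpenMap ?_ ?_ ?_
  · exact ⟨fun W hW => (G.isOpen_iff W).1 hW i⟩
  · intro x y h
    simpa [G.f_self] using (G.φ_eq_iff.1 h).2
  · intro V hV
    rw [isOpen_iff]
    intro j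
    have : G.φ j ⁻¹' (G.φ i '' V) = G.U j i ∩ G.f j i ⁻¹' V := by
      ext y
      constructor
      · rintro ⟨x, hx, h⟩
        obtain ⟨h1, h2⟩ := G.φ_eq_iff.1 h.symm
        exact ⟨h1, by simpa [h2] using hx⟩
      · rintro ⟨h1, h2⟩
        exact ⟨_, h2, (G.φ_eq_iff.2 ⟨h1, rfl⟩).symm⟩
    rw [this]
    exact (G.smooth_f j i).continuousOn.isOpen_inter_preimage (G.isOpen_U j i) hV

/-- The chart `(φ_i(V), e ∘ φ_i⁻¹)` of the colimit induced by a chart `(V, e)` of `M i`. -/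
noncomputable def liftChart (i : Fin n) (e : OpenPartialHomeomorph (M i) (Euc d)) :
    OpenPartialHomeomorph G.Colimit (Euc d) :=
  e.lift_openEmbedding (G.isOpenEmbedding_φ i)

/-- The smooth atlas of the colimit: all charts induced by the charts of the `M i`. -/
noncomputable instance : ChartedSpace (Euc d) G.Colimit where
  atlas := {c | ∃ i, ∃ e ∈ atlas (Euc d) (M i), c = G.liftChart i e}
  chartAt q := G.liftChart (Quotient.out q).1 (chartAt (Euc d) (Quotient.out q).2)
  mem_chart_source q := by
    refine ⟨(Quotient.out q).2, mem_chart_source _ _, ?_⟩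
    exact Quotient.out_eq q
  chart_mem_atlas q := ⟨_, _, chart_mem_atlas _ _, rfl⟩

theorem liftChart_symm_apply (i : Fin n) (e : OpenPartialHomeomorph (M i) (Euc d)) (y) :
    (G.liftChart i e).symm y = G.φ i (e.symm y) := by
  simp [liftChart]

theorem liftChart_apply (i : Fin n) (e : OpenPartialHomeomorph (M i) (Euc d)) (x) :
    (G.liftChart i e) (G.φ i x) = e x := by
  simp [liftChart, (G.isOpenEmbedding_φ i).injective.extend_apply]

/-- The colimit of smooth manifolds is a smooth (in general non-Hausdorff) manifold. -/
instance [∀ i, IsManifold 𝓘(ℝ, Euc d) ∞ (M i)] : IsManifold 𝓘(ℝ, Euc d) ∞ G.Colimit := by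
  apply isManifold_of_contDiffOn
  rintro c c' ⟨i, e, he, rfl⟩ ⟨j, e', he', rfl⟩
  have hs : ∀ y ∈ e.target, G.φ i (e.symm y) ∈ (G.liftChart j e').source →
      e.symm y ∈ G.U i j ∧ G.f i j (e.symm y) ∈ e'.source := by
    rintro y hy ⟨z, hz, h⟩
    obtain ⟨h1, h2⟩ := G.φ_eq_iff.1 h.symm
    exact ⟨h1, by rwa [h2]⟩
  have : ContDiffOn ℝ ∞ (fun y => e' (G.f i j (e.symm y)))
      {y | y ∈ e.target ∧ e.symm y ∈ G.U i j ∧ G.f i j (e.symm y) ∈ e'.source} := by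
    rw [← contMDiffOn_iff_contDiffOn]
    refine (contMDiffOn_of_mem_maximalAtlas (IsManifold.subset_maximalAtlas he')).comp
      ((G.smooth_f i j).comp
        (s := {y | y ∈ e.target ∧ e.symm y ∈ G.U i j ∧ G.f i j (e.symm y) ∈ e'.source})
        ((contMDiffOn_symm_of_mem_maximalAtlas (IsManifold.subset_maximalAtlas he)).mono ?_) ?_) ?_
    · exact fun y hy => hy.1
    · exact fun y hy => hy.2.1
    · exact fun y hy => hy.2.2
  refine ContDiffOn.congr_mono this ?_ ?_
  · rintro y ⟨hy, -⟩
    simp at hy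
    have := hs y (by simpa [liftChart] using hy.1) (by simpa [liftChart_symm_apply] using hy.2)
    simp [liftChart_symm_apply]
    rw [← liftChart_apply G, G.φ_eq_iff.2 ⟨this.1, rfl⟩]
  · rintro y ⟨hy, -⟩
    simp at hy
    have h1 : y ∈ e.target := (by simpa [liftChart] using hy.1)
    exact ⟨h1, hs y h1 (by simpa [liftChart_symm_apply] using hy.2)⟩

/-- The orientation of the colimit induced by orientations `𝒪 i` of the `M i`. -/
def orientation (𝒪 : ∀ i, Set (OpenPartialHomeomorph (M i) (Euc d))) :
    Set (OpenPartialHomeomorph G.Colimit (Euc d)) :=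
  {c | ∃ i, ∃ e ∈ 𝒪 i, c = G.liftChart i e}

/-- The gluing regions have diffeomorphic boundaries: the closures of the `U i j` are regular
domains, and the gluing maps extend to diffeomorphisms `F i j` between these closures, which
again satisfy the conditions of an adjunction system. -/
def HasDiffeomorphicBoundaries : Prop :=
  (∀ i j, IsRegularDomain d (closure (G.U i j))) ∧
  ∃ F : ∀ i j, M i → M j,
    (∀ i j, EqOn (F i j) (G.f i j) (G.U i j)) ∧
    (∀ i j, SmoothOnSet d (F i j) (closure (G.U i j))) ∧
    (∀ i j, MapsTo (F i j) (closure (G.U i j)) (closure (G.U j i))) ∧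
    (∀ i j, ∀ x ∈ closure (G.U i j), F j i (F i j x) = x) ∧
    (∀ i j k x, x ∈ closure (G.U i j) → x ∈ closure (G.U i k) →
      F i j x ∈ closure (G.U j k) ∧ F j k (F i j x) = F i k x)

/-- The intersection `M_{i₁…i_p}` in the colimit of the (images of the) `M i`,
`i ∈ s = {i₁, …, i_p}`. -/
def inter (s : Finset (Fin n)) : Set G.Colimit := ⋂ i ∈ s, range (G.φ i)

/-- The closure in `M i` of the intersection `M_{i₁…i_p}`, seen as a subset of `M i`; here
`s = {i₁, …, i_p}` contains `i`. -/
def closureIn (s : Finset (Fin n)) (i : Fin n) : Set (M i) := closure (G.φ i ⁻¹' G.inter s)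

/-- The integral of `η` over the closure of `M_{i₁…i_p}`, where `i₁ < ⋯ < i_p` are the elements
of the non-empty set `s`. The closure is taken in `M_{i₁}`. -/
noncomputable def integralClosure (𝒪 : ∀ i, Set (OpenPartialHomeomorph (M i) (Euc d)))
    (η : TopForm d G.Colimit) (s : Finset (Fin n)) : ℝ :=
  if h : s.Nonempty then
    formIntegral (𝒪 (s.min' h)) (G.closureIn s (s.min' h)) (TopForm.pullback (G.φ (s.min' h)) η)
  else 0

end AdjunctionSystem

/-!
Two points of a space are non-separated when every neighbourhood of one meets every neighbourhood
of the other. In the colimit, `φ i x` and `φ j y` are non-separated exactly when `x` lies in the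
closure of `U i j` and the extended gluing map `F i j` sends `x` to `y`
(`IsClosureGluing.nonSep_φ_iff`); by the cocycle condition for the `F i j`, this is an equivalence
relation. The integral only sees the classes of this relation.

Indeed, the images of a parametrisation consist of pairwise separated points: they are disjoint
open sets, each homeomorphic to an open subset of Euclidean space. On the other hand, a point of
the closure of such an image is a limit of values of `a α` on the bounded set `A α`, hence
non-separated from a value of `a α` on `closure (A α)`; here the frontier of `A α` is null. So
the images of the `A α` contain at most one representative of each class and, up to null sets, one
of each class on which the form does not vanish. The integral over any other measurable system of
representatives is the same, because representatives of the same classes in `M i` and in `M j`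
correspond under `F i j`, which is smooth up to the boundary and, by continuity, respects the form
there and has nonnegative Jacobian. This is `Parametrisation.value_eq_sum_integral`; it applies to Hausdorff
manifolds too, where non-separation is equality, and gives the independence of the choice of a
parametrisation.

For the formula, rank the `M k`, and choose in each class the representative of highest rank. These
representatives form the open sets `region σ k`, the complements in `M k` of the closures of the
`U k j` with `j` of higher rank than `k`. Hence `∫_𝐌 η = ∑_k ∫_{region σ k} (φ k)^* η`, and
inclusion-exclusion in each `M k` gives integrals over the sets `⋂ j ∈ u, closure (U k j)`. They
agree with the closures of the intersections up to null sets, the frontiers of regular domains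
being null (`isNullSet_biInter_closure_diff`). With the natural ranking, `k` is the least element
of `insert k u`, which is the general formula; the binary formula uses a ranking in which `i`
comes below `j`.

Parametrisations exist because the trace of the support on each `M k` is compact
(`IsClosureGluing.isCompact_preimage_φ`): it is covered by finitely many chart balls, which are cut
into disjoint pieces along spheres and along the frontiers of regular domains.
-/

/-! ### Densities of top forms along smooth maps -/

section Density

variable {d : ℕ} {X Y : Type*} [TopologicalSpace X] [ChartedSpace (Euc d) X]
  [TopologicalSpace Y] [ChartedSpace (Euc d) Y]

/-- The function `h` with `g^* η = h dx¹ ∧ ⋯ ∧ dx^d`, for a map `g` from Euclidean space. -/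
noncomputable def TopForm.density (g : Euc d → X) (η : TopForm d X) (y : Euc d) : ℝ :=
  TopForm.pullback g η y (fun k => EuclideanSpace.basisFun (Fin d) ℝ k)

/-- An alternating top form evaluated on the images of the standard basis. -/
theorem alternating_comp_basisFun (τ : (Euc d) [⋀^Fin d]→L[ℝ] ℝ) (L : Euc d →L[ℝ] Euc d) :
    τ (fun k => L (EuclideanSpace.basisFun (Fin d) ℝ k)) =
      L.det * τ (fun k => EuclideanSpace.basisFun (Fin d) ℝ k) := by
  have h := AlternatingMap.eq_smul_basis_det (EuclideanSpace.basisFun (Fin d) ℝ).toBasis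
    τ.toAlternatingMap
  have h1 : ∀ v, τ v = τ.toAlternatingMap v := fun v => rfl
  rw [h1, h, AlternatingMap.smul_apply]
  have h2 := (EuclideanSpace.basisFun (Fin d) ℝ).toBasis.det_comp (L : Euc d →ₗ[ℝ] Euc d)
    (EuclideanSpace.basisFun (Fin d) ℝ).toBasis
  rw [Module.Basis.det_self, mul_one] at h2
  have h3 : (fun k => L (EuclideanSpace.basisFun (Fin d) ℝ k)) =
    (L : Euc d →ₗ[ℝ] Euc d) ∘ (EuclideanSpace.basisFun (Fin d) ℝ).toBasis := by
    ext k; simp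
  rw [h3, h2]
  rw [OrthonormalBasis.coe_toBasis, smul_eq_mul, mul_comm]
  rfl

theorem alternating_eq_zero_of_basisFun {τ : (Euc d) [⋀^Fin d]→L[ℝ] ℝ}
    (h : τ (fun k => EuclideanSpace.basisFun (Fin d) ℝ k) = 0) : τ = 0 := by
  have h' := AlternatingMap.eq_smul_basis_det (EuclideanSpace.basisFun (Fin d) ℝ).toBasis
    τ.toAlternatingMap
  have h2 : τ.toAlternatingMap (EuclideanSpace.basisFun (Fin d) ℝ).toBasis = 0 := by
    rw [OrthonormalBasis.coe_toBasis]
    exact h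
  rw [h2, zero_smul] at h'
  ext v
  exact congrArg (fun f : (Euc d) [⋀^Fin d]→ₗ[ℝ] ℝ => f v) h'

theorem TopForm.density_congr {g g' : Euc d → X} {η : TopForm d X} {y : Euc d}
    (h : g =ᶠ[𝓝 y] g') : TopForm.density g η y = TopForm.density g' η y := by
  have h1 : (η (g y) : (Euc d) [⋀^Fin d]→L[ℝ] ℝ) = η (g' y) :=
    @congrArg X ((Euc d) [⋀^Fin d]→L[ℝ] ℝ) _ _ η h.self_of_nhds
  have h2 : (mfderiv 𝓘(ℝ, Euc d) 𝓘(ℝ, Euc d) g y : Euc d →L[ℝ] Euc d) =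
    mfderiv 𝓘(ℝ, Euc d) 𝓘(ℝ, Euc d) g' y := h.mfderiv_eq
  change (η (g y) : (Euc d) [⋀^Fin d]→L[ℝ] ℝ)
      (fun k => (mfderiv 𝓘(ℝ, Euc d) 𝓘(ℝ, Euc d) g y : Euc d →L[ℝ] Euc d) _) =
    (η (g' y) : (Euc d) [⋀^Fin d]→L[ℝ] ℝ)
      (fun k => (mfderiv 𝓘(ℝ, Euc d) 𝓘(ℝ, Euc d) g' y : Euc d →L[ℝ] Euc d) _)
  rw [h1, h2]
  rfl

/-- Reparametrising multiplies the density by the Jacobian determinant. -/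
theorem TopForm.density_comp {g : Euc d → X} {φ : Euc d → Euc d} {η : TopForm d X} {y : Euc d}
    (hg : MDifferentiableAt 𝓘(ℝ, Euc d) 𝓘(ℝ, Euc d) g (φ y)) (hφ : DifferentiableAt ℝ φ y) :
    TopForm.density (g ∘ φ) η y = (fderiv ℝ φ y).det * TopForm.density g η (φ y) := by
  have h := mfderiv_comp y hg hφ.mdifferentiableAt
  have h2 := alternating_comp_basisFun ((η (g (φ y))).compContinuousLinearMap
    (mfderiv 𝓘(ℝ, Euc d) 𝓘(ℝ, Euc d) g (φ y))) (fderiv ℝ φ y)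
  refine Eq.trans ?_ h2
  rw [← mfderiv_eq_fderiv]
  change (η (g (φ y))) (fun k => mfderiv 𝓘(ℝ, Euc d) 𝓘(ℝ, Euc d) (g ∘ φ) y _) = _
  rw [h]
  rfl

theorem TopForm.density_pullback {φ : Y → X} {g : Euc d → Y} {η : TopForm d X} {y : Euc d}
    (hφ : MDifferentiableAt 𝓘(ℝ, Euc d) 𝓘(ℝ, Euc d) φ (g y))
    (hg : MDifferentiableAt 𝓘(ℝ, Euc d) 𝓘(ℝ, Euc d) g y) :
    TopForm.density g (TopForm.pullback φ η) y = TopForm.density (φ ∘ g) η y := by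
  have h := mfderiv_comp y hφ hg
  change _ = (η (φ (g y))) (fun k => mfderiv 𝓘(ℝ, Euc d) 𝓘(ℝ, Euc d) (φ ∘ g) y _)
  rw [h]
  rfl

theorem TopForm.ne_zero_of_density_ne_zero {g : Euc d → X} {η : TopForm d X} {y : Euc d}
    (h : TopForm.density g η y ≠ 0) : η (g y) ≠ 0 := by
  intro h0
  apply h
  change (η (g y)) (fun k => _) = 0
  rw [h0]
  rfl

/-- In a chart, the density of a form vanishes only where the form does. -/
theorem TopForm.density_chart_symm_ne_zero {e : OpenPartialHomeomorph X (Euc d)}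
    [IsManifold 𝓘(ℝ, Euc d) ∞ X]
    (he : e ∈ IsManifold.maximalAtlas 𝓘(ℝ, Euc d) ∞ X) {η : TopForm d X} {x : X}
    (hx : x ∈ e.source) (h : η x ≠ 0) : TopForm.density e.symm η (e x) ≠ 0 := by
  intro h0
  have h1 : e.symm (e x) = x := e.left_inv hx
  have hd : MDifferentiableAt 𝓘(ℝ, Euc d) 𝓘(ℝ, Euc d) e x :=
    (contMDiffAt_of_mem_maximalAtlas he hx).mdifferentiableAt (by simp)
  have hs : MDifferentiableAt 𝓘(ℝ, Euc d) 𝓘(ℝ, Euc d) e.symm (e x) :=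
    (contMDiffAt_symm_of_mem_maximalAtlas he (e.map_source hx)).mdifferentiableAt (by simp)
  have hz := alternating_eq_zero_of_basisFun h0
  apply h
  have h2 := mfderiv_comp x hs hd
  have h3 : mfderiv 𝓘(ℝ, Euc d) 𝓘(ℝ, Euc d) (e.symm ∘ e) x =
      mfderiv 𝓘(ℝ, Euc d) 𝓘(ℝ, Euc d) (id : X → X) x := by
    apply Filter.EventuallyEq.mfderiv_eq
    filter_upwards [e.open_source.mem_nhds hx] with z hz using e.left_inv hz
  rw [h3, mfderiv_id] at h2
  have h4 : (η (e.symm (e x)) : (Euc d) [⋀^Fin d]→L[ℝ] ℝ) = η x :=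
    @congrArg X ((Euc d) [⋀^Fin d]→L[ℝ] ℝ) _ _ η h1
  ext v
  have h5 := congrArg (fun τ : (Euc d) [⋀^Fin d]→L[ℝ] ℝ =>
    τ (fun k => mfderiv 𝓘(ℝ, Euc d) 𝓘(ℝ, Euc d) e x (v k))) hz
  refine Eq.trans ?_ h5
  change (η x : (Euc d) [⋀^Fin d]→L[ℝ] ℝ) v = (η (e.symm (e x)) : (Euc d) [⋀^Fin d]→L[ℝ] ℝ)
    (fun k => (mfderiv 𝓘(ℝ, Euc d) 𝓘(ℝ, Euc d) e.symm (e x))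
      (mfderiv 𝓘(ℝ, Euc d) 𝓘(ℝ, Euc d) e x (v k)))
  rw [h4]
  congr 1
  ext1 k
  exact congrArg (fun L : Euc d →L[ℝ] Euc d => L (v k)) h2

/-- A form is continuous when its density along every smooth map from an open set of Euclidean
space is. -/
def TopForm.IsContinuous (η : TopForm d X) : Prop :=
  ∀ (g : Euc d → X) (V : Set (Euc d)), IsOpen V → ContMDiffOn 𝓘(ℝ, Euc d) 𝓘(ℝ, Euc d) ∞ g V →
    ContinuousOn (TopForm.density g η) V

theorem TopForm.IsSmooth.isContinuous [IsManifold 𝓘(ℝ, Euc d) ∞ X] {η : TopForm d X}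
    (hη : η.IsSmooth) : η.IsContinuous := by
  intro g V hV hg y hy
  apply ContinuousAt.continuousWithinAt
  set c := chartAt (Euc d) (g y) with hc
  have hcm : c ∈ IsManifold.maximalAtlas 𝓘(ℝ, Euc d) ∞ X :=
    IsManifold.chart_mem_maximalAtlas _
  set W := V ∩ g ⁻¹' c.source with hW
  have hWo : IsOpen W := hg.continuousOn.isOpen_inter_preimage hV c.open_source
  have hyW : y ∈ W := ⟨hy, mem_chart_source _ _⟩
  have hcg : ContDiffOn ℝ ∞ (c ∘ g) W := by
    rw [← contMDiffOn_iff_contDiffOn]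
    exact (contMDiffOn_of_mem_maximalAtlas hcm).comp (hg.mono inter_subset_left)
      fun z hz => hz.2
  have key : ∀ z ∈ W, TopForm.density g η z =
      (fderiv ℝ (c ∘ g) z).det * TopForm.density c.symm η (c (g z)) := by
    intro z hz
    have h1 : MDifferentiableAt 𝓘(ℝ, Euc d) 𝓘(ℝ, Euc d) c.symm ((c ∘ g) z) :=
      (contMDiffAt_symm_of_mem_maximalAtlas hcm (c.map_source hz.2)).mdifferentiableAt (by simp)
    have h2 := TopForm.density_comp (η := η) h1
      ((hcg.contDiffAt (hWo.mem_nhds hz)).differentiableAt (by simp))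
    refine Eq.trans (TopForm.density_congr ?_) h2
    filter_upwards [hWo.mem_nhds hz] with w hw using (c.left_inv hw.2).symm
  refine ContinuousAt.congr ?_ (Filter.eventuallyEq_of_mem (hWo.mem_nhds hyW) fun z hz =>
    (key z hz).symm)
  refine ContinuousAt.mul ?_ ?_
  · have : ContinuousOn (fderiv ℝ (c ∘ g)) W := hcg.continuousOn_fderiv_of_isOpen hWo (by simp)
    exact ContinuousLinearMap.continuous_det.continuousAt.comp
      (this.continuousAt (hWo.mem_nhds hyW))
  · have h1 : ContinuousOn (TopForm.density c.symm η) c.target := by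
      have := (hη (g y)).continuousOn
      have hev : Continuous (fun τ : (Euc d) [⋀^Fin d]→L[ℝ] ℝ =>
          τ (fun k => EuclideanSpace.basisFun (Fin d) ℝ k)) :=
        continuous_eval_const _
      exact hev.comp_continuousOn this
    have h2 : ContinuousAt (c ∘ g) y := hcg.continuousOn.continuousAt (hWo.mem_nhds hyW)
    exact (h1.continuousAt (c.open_target.mem_nhds (c.map_source hyW.2))).comp (f := c ∘ g) h2

theorem TopForm.IsContinuous.pullback {η : TopForm d X} (hη : η.IsContinuous) {φ : Y → X}
    (hφ : ContMDiff 𝓘(ℝ, Euc d) 𝓘(ℝ, Euc d) ∞ φ) : (TopForm.pullback φ η).IsContinuous := by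
  intro g V hV hg
  refine (hη (φ ∘ g) V hV (hφ.comp_contMDiffOn hg)).congr fun y hy => ?_
  exact TopForm.density_pullback (hφ.mdifferentiableAt (by simp))
    ((hg.contMDiffAt (hV.mem_nhds hy)).mdifferentiableAt (by simp))

theorem TopForm.IsContinuous.isOpen_ne_zero [IsManifold 𝓘(ℝ, Euc d) ∞ X] {η : TopForm d X}
    (hη : η.IsContinuous) : IsOpen {x | η x ≠ 0} := by
  rw [isOpen_iff_mem_nhds]
  intro x hx
  have hcm : chartAt (Euc d) x ∈ IsManifold.maximalAtlas 𝓘(ℝ, Euc d) ∞ X :=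
    IsManifold.chart_mem_maximalAtlas _
  set c := chartAt (Euc d) x
  have hxc : x ∈ c.source := mem_chart_source _ _
  have h1 := (hη c.symm c.target c.open_target
    (contMDiffOn_symm_of_mem_maximalAtlas hcm)).continuousAt
      (c.open_target.mem_nhds (c.map_source hxc))
  have h2 : ContinuousAt (fun z => TopForm.density c.symm η (c z)) x :=
    ContinuousAt.comp (f := c) h1 (c.continuousAt hxc)
  filter_upwards [h2.eventually_ne (TopForm.density_chart_symm_ne_zero hcm hxc hx),
    c.open_source.mem_nhds hxc] with z hz hzc
  have := TopForm.ne_zero_of_density_ne_zero hz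
  intro h0
  apply this
  have h4 : (η (c.symm (c z)) : (Euc d) [⋀^Fin d]→L[ℝ] ℝ) = η z :=
    @congrArg X ((Euc d) [⋀^Fin d]→L[ℝ] ℝ) _ _ η (c.left_inv hzc)
  exact h4.trans h0

end Density

/-! ### Non-separated points and smooth retractions -/

section NonSep

variable {d : ℕ} {X Y : Type*} [TopologicalSpace X] [ChartedSpace (Euc d) X]
  [TopologicalSpace Y] [ChartedSpace (Euc d) Y]

/-- Two points are non-separated when each neighbourhood of one meets each neighbourhood of the
other. In a Hausdorff space this is equality. -/
def NonSep {X : Type*} [TopologicalSpace X] (x y : X) : Prop := (𝓝 x ⊓ 𝓝 y).NeBot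

theorem NonSep.refl (x : X) : NonSep x x := by
  unfold NonSep; rw [inf_idem]; infer_instance

theorem NonSep.symm {x y : X} (h : NonSep x y) : NonSep y x := by
  unfold NonSep at *; rwa [inf_comm]

theorem NonSep.eq [T2Space X] {x y : X} (h : NonSep x y) : x = y :=
  haveI : (𝓝 x ⊓ 𝓝 y).NeBot := h
  eq_of_nhds_neBot h

theorem NonSep.nonempty_inter {x y : X} (h : NonSep x y) {V W : Set X} (hV : IsOpen V)
    (hx : x ∈ V) (hW : IsOpen W) (hy : y ∈ W) : (V ∩ W).Nonempty :=
  haveI : (𝓝 x ⊓ 𝓝 y).NeBot := h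
  Filter.nonempty_of_mem (Filter.inter_mem_inf (hV.mem_nhds hx) (hW.mem_nhds hy))

theorem SmoothOnSet.continuousOn {g : X → Y} {s : Set X} (h : SmoothOnSet d g s) :
    ContinuousOn g s := by
  intro x hx
  obtain ⟨V, k, hV, hxV, hk, he⟩ := h x hx
  have h1 : ContinuousWithinAt k s x :=
    (hk.continuousOn.continuousAt (hV.mem_nhds hxV)).continuousWithinAt
  refine h1.congr_of_eventuallyEq ?_ (he ⟨hx, hxV⟩).symm
  filter_upwards [self_mem_nhdsWithin, mem_nhdsWithin_of_mem_nhds (hV.mem_nhds hxV)] with z hz hz'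
    using (he ⟨hz, hz'⟩).symm

theorem SmoothOnSet.contMDiffOn {g : X → Y} {s t : Set X} (h : SmoothOnSet d g s)
    (ht : IsOpen t) (hts : t ⊆ s) : ContMDiffOn 𝓘(ℝ, Euc d) 𝓘(ℝ, Euc d) ∞ g t := by
  intro x hx
  obtain ⟨V, k, hV, hxV, hk, he⟩ := h x (hts hx)
  refine ContMDiffAt.contMDiffWithinAt ?_
  refine (hk.contMDiffAt (hV.mem_nhds hxV)).congr_of_eventuallyEq ?_
  filter_upwards [ht.mem_nhds hx, hV.mem_nhds hxV] with z hz hz' using (he ⟨hts hz, hz'⟩).symm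

/-- `ρ` retracts the closure of the open set `Ω` smoothly onto `Ω`, by moving each point to the
unique point of `Ω` from which it is not separated. -/
structure IsSmoothRetraction (d : ℕ) {X : Type*} [TopologicalSpace X] [ChartedSpace (Euc d) X]
    (Ω : Set X) (ρ : X → X) : Prop where
  isOpen : IsOpen Ω
  smooth : SmoothOnSet d ρ (closure Ω)
  mem : ∀ x ∈ closure Ω, ρ x ∈ Ω
  nonSep : ∀ x ∈ closure Ω, NonSep x (ρ x)
  unique : ∀ x ∈ closure Ω, ∀ w ∈ Ω, NonSep x w → w = ρ x

theorem IsSmoothRetraction.apply_of_mem {Ω : Set X} {ρ : X → X} (h : IsSmoothRetraction d Ω ρ)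
    {x : X} (hx : x ∈ Ω) : ρ x = x :=
  (h.unique x (subset_closure hx) x hx (NonSep.refl x)).symm

theorem NonSep.mem_closure {x y : X} {Ω : Set X} (h : NonSep x y) (hΩ : IsOpen Ω) (hy : y ∈ Ω) :
    x ∈ closure Ω := by
  rw [mem_closure_iff]
  exact fun V hV hx => h.nonempty_inter hV hx hΩ hy

theorem isSmoothRetraction_univ [T2Space X] : IsSmoothRetraction d (univ : Set X) id where
  isOpen := isOpen_univ
  smooth := fun _ _ => ⟨univ, id, isOpen_univ, mem_univ _, contMDiffOn_id, fun _ _ => rfl⟩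
  mem := fun _ _ => mem_univ _
  nonSep := fun x _ => NonSep.refl x
  unique := fun _ _ _ _ h => h.eq.symm

/-- Let `a` be a positively oriented parametrisation of an open subset of `X`, and `c` a chart
inside `Ω`. In the chart, `ρ ∘ a` extends locally to a smooth map `g`, and the densities of `η`
along `a` and along `c⁻¹` are related by the Jacobian of `g`. At a point that `a` maps to the
boundary of `Ω` this holds because both sides are continuous and `a` maps nearby points
to `Ω`, where `ρ` is the identity. -/
theorem IsSmoothRetraction.exists_local_extension [IsManifold 𝓘(ℝ, Euc d) ∞ X]
    {Ω : Set X} {ρ : X → X} (hρ : IsSmoothRetraction d Ω ρ) {η : TopForm d X}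
    (hη : η.IsContinuous) {c : OpenPartialHomeomorph X (Euc d)}
    (hc : c ∈ IsManifold.maximalAtlas 𝓘(ℝ, Euc d) ∞ X)
    {a : Euc d → X} {A : Set (Euc d)} (hA : IsOpen A)
    (ha : ContMDiffOn 𝓘(ℝ, Euc d) 𝓘(ℝ, Euc d) ∞ a A)
    (hopen : ∀ V ⊆ A, IsOpen V → IsOpen (a '' V))
    (hor : ∀ y ∈ A, a y ∈ c.source → 0 < (fderiv ℝ (c ∘ a) y).det)
    {y : Euc d} (hy : y ∈ A) (hyΩ : a y ∈ closure Ω) (hyc : ρ (a y) ∈ c.source) :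
    ∃ (V : Set (Euc d)) (g : Euc d → Euc d), IsOpen V ∧ y ∈ V ∧ ContDiffOn ℝ ∞ g V ∧
      (∀ z ∈ V, a z ∈ closure Ω → g z = c (ρ (a z))) ∧ 0 ≤ (fderiv ℝ g y).det ∧
      TopForm.density a η y = (fderiv ℝ g y).det * TopForm.density c.symm η (g y) := by
  obtain ⟨V₀, h, hV₀, hyV₀, hh, he⟩ := hρ.smooth _ hyΩ
  set V₁ := A ∩ a ⁻¹' V₀ with hV₁
  have hV₁o : IsOpen V₁ := ha.continuousOn.isOpen_inter_preimage hA hV₀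
  have hha : ContMDiffOn 𝓘(ℝ, Euc d) 𝓘(ℝ, Euc d) ∞ (h ∘ a) V₁ :=
    hh.comp (ha.mono inter_subset_left) fun z hz => hz.2
  set V := V₁ ∩ (h ∘ a) ⁻¹' c.source with hV
  have hVo : IsOpen V := hha.continuousOn.isOpen_inter_preimage hV₁o c.open_source
  have hhy : h (a y) = ρ (a y) := he ⟨hyΩ, hyV₀⟩
  have hyV : y ∈ V := ⟨⟨hy, hyV₀⟩, by simpa [hhy] using hyc⟩
  set g : Euc d → Euc d := c ∘ (h ∘ a) with hg
  have hgs : ContDiffOn ℝ ∞ g V := by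
    rw [← contMDiffOn_iff_contDiffOn]
    exact (contMDiffOn_of_mem_maximalAtlas hc).comp (hha.mono inter_subset_left)
      fun z hz => hz.2
  set W := V ∩ a ⁻¹' Ω with hW
  have hWo : IsOpen W := (ha.continuousOn.mono fun z hz => hz.1.1).isOpen_inter_preimage
    hVo hρ.isOpen
  have hyW : y ∈ closure W := by
    rw [mem_closure_iff]
    intro N hN hyN
    have h1 : IsOpen (a '' (N ∩ V)) := hopen _ (fun z hz => hz.2.1.1) (hN.inter hVo)
    obtain ⟨_, ⟨z, hz, rfl⟩, hzΩ⟩ := mem_closure_iff.1 hyΩ _ h1 (mem_image_of_mem a ⟨hyN, hyV⟩)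
    exact ⟨z, hz.1, hz.2, hzΩ⟩
  have hWh : ∀ z ∈ W, h (a z) = a z := fun z hz =>
    (he ⟨subset_closure hz.2, hz.1.1.2⟩).trans (hρ.apply_of_mem hz.2)
  have hWc : ∀ z ∈ W, a z ∈ c.source := fun z hz => by
    have := hz.1.2
    rwa [mem_preimage, Function.comp_apply, hWh z hz] at this
  have hdet : ∀ z ∈ W, 0 ≤ (fderiv ℝ g z).det := by
    intro z hz
    have : fderiv ℝ g z = fderiv ℝ (c ∘ a) z := by
      apply Filter.EventuallyEq.fderiv_eq
      filter_upwards [hWo.mem_nhds hz] with w hw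
      simp [hg, hWh w hw]
    rw [this]
    exact (hor z hz.1.1.1 (hWc z hz)).le
  have hdens : ∀ z ∈ W, TopForm.density a η z -
      (fderiv ℝ g z).det * TopForm.density c.symm η (g z) = 0 := by
    intro z hz
    have h1 : MDifferentiableAt 𝓘(ℝ, Euc d) 𝓘(ℝ, Euc d) c.symm (g z) :=
      (contMDiffAt_symm_of_mem_maximalAtlas hc (c.map_source hz.1.2)).mdifferentiableAt (by simp)
    rw [← TopForm.density_comp h1 ((hgs.contDiffAt (hVo.mem_nhds hz.1)).differentiableAt
      (by simp)), sub_eq_zero]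
    apply TopForm.density_congr
    filter_upwards [hWo.mem_nhds hz] with w hw
    simp [hg, hWh w hw, c.left_inv (hWc w hw)]
  have hcd : ContinuousAt (fun z => (fderiv ℝ g z).det) y := by
    have : ContinuousOn (fderiv ℝ g) V := hgs.continuousOn_fderiv_of_isOpen hVo (by simp)
    exact ContinuousAt.comp (f := fderiv ℝ g) ContinuousLinearMap.continuous_det.continuousAt
      (this.continuousAt (hVo.mem_nhds hyV))
  have hca : ContinuousAt (TopForm.density a η) y :=
    (hη a A hA ha).continuousAt (hA.mem_nhds hy)
  have hcc : ContinuousAt (fun z => TopForm.density c.symm η (g z)) y :=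
    ContinuousAt.comp (f := g) ((hη c.symm c.target c.open_target
      (contMDiffOn_symm_of_mem_maximalAtlas hc)).continuousAt
        (c.open_target.mem_nhds (c.map_source hyV.2)))
      (hgs.continuousOn.continuousAt (hVo.mem_nhds hyV))
  have hfr : ∃ᶠ z in 𝓝 y, z ∈ W := mem_closure_iff_frequently.1 hyW
  refine ⟨V, g, hVo, hyV, hgs, fun z hz hzΩ => ?_, ?_, ?_⟩
  · exact congrArg c (he ⟨hzΩ, hz.1.2⟩)
  · exact isClosed_Ici.mem_of_frequently_of_tendsto (hfr.mono hdet) hcd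
  · exact sub_eq_zero.1 (isClosed_singleton.mem_of_frequently_of_tendsto (hfr.mono hdens)
      (hca.sub (hcd.mul hcc)))

/-- The part of `A` that `ρ ∘ a` maps to the part of the chart `c` with coordinates in `E`. -/
def coordPreimage (Ω : Set X) (ρ : X → X) (c : OpenPartialHomeomorph X (Euc d))
    (E : Set (Euc d)) (a : Euc d → X) (A : Set (Euc d)) : Set (Euc d) :=
  {y | y ∈ A ∧ a y ∈ closure Ω ∧ ρ (a y) ∈ c.source ∧ c (ρ (a y)) ∈ E}

theorem measurableSet_preimage_of_continuousOn {Z Z' : Type*} [TopologicalSpace Z]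
    [TopologicalSpace Z'] [MeasurableSpace Z] [BorelSpace Z] [MeasurableSpace Z'] [BorelSpace Z']
    {f : Z → Z'} {s : Set Z} (hf : ContinuousOn f s) (hs : MeasurableSet s) {t : Set Z'}
    (ht : MeasurableSet t) : MeasurableSet (s ∩ f ⁻¹' t) := by
  have h1 : Measurable (s.domRestrict f) :=
    (continuousOn_iff_continuous_domRestrict.1 hf).measurable
  have h2 := (MeasurableEmbedding.subtype_coe hs).measurableSet_image.2 (h1 ht)
  convert h2 using 1
  ext z
  simp [and_comm]

theorem measurableSet_coordPreimage {Ω : Set X} {ρ : X → X}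
    (hρ : IsSmoothRetraction d Ω ρ) {c : OpenPartialHomeomorph X (Euc d)} {E : Set (Euc d)}
    (hE : MeasurableSet E) {a : Euc d → X} {A : Set (Euc d)} (hA : IsOpen A)
    (ha : ContinuousOn a A) : MeasurableSet (coordPreimage Ω ρ c E a A) := by
  have h1 : MeasurableSet (A ∩ a ⁻¹' closure Ω) := by
    have : A ∩ a ⁻¹' closure Ω = A \ (A ∩ a ⁻¹' (closure Ω)ᶜ) := by
      ext z; simp +contextual
    rw [this]
    exact hA.measurableSet.diff
      (ha.isOpen_inter_preimage hA isClosed_closure.isOpen_compl).measurableSet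
  have h2 : ContinuousOn (ρ ∘ a) (A ∩ a ⁻¹' closure Ω) :=
    hρ.smooth.continuousOn.comp (ha.mono inter_subset_left) fun z hz => hz.2
  have h3 : MeasurableSet ((A ∩ a ⁻¹' closure Ω) ∩ (ρ ∘ a) ⁻¹' c.source) := by
    obtain ⟨u, hu, hu'⟩ := continuousOn_iff'.1 h2 _ c.open_source
    rw [inter_comm, hu', inter_comm]
    exact h1.inter hu.measurableSet
  have h4 : ContinuousOn (c ∘ (ρ ∘ a)) ((A ∩ a ⁻¹' closure Ω) ∩ (ρ ∘ a) ⁻¹' c.source) :=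
    c.continuousOn.comp (h2.mono inter_subset_left) fun z hz => hz.2
  convert measurableSet_preimage_of_continuousOn h4 h3 hE using 1
  ext z
  simp only [coordPreimage, mem_ofPred_eq, mem_inter_iff, mem_preimage, Function.comp_apply]
  tauto

/-- The change of variables `c ∘ ρ ∘ a` between pieces of two parametrisations. -/
theorem IsSmoothRetraction.integral_coordPreimage [IsManifold 𝓘(ℝ, Euc d) ∞ X]
    {Ω : Set X} {ρ : X → X} (hρ : IsSmoothRetraction d Ω ρ) {η : TopForm d X}
    (hη : η.IsContinuous) {c : OpenPartialHomeomorph X (Euc d)}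
    (hc : c ∈ IsManifold.maximalAtlas 𝓘(ℝ, Euc d) ∞ X)
    {a : Euc d → X} {A : Set (Euc d)} (hA : IsOpen A)
    (ha : ContMDiffOn 𝓘(ℝ, Euc d) 𝓘(ℝ, Euc d) ∞ a A)
    (hopen : ∀ V ⊆ A, IsOpen V → IsOpen (a '' V))
    (hor : ∀ y ∈ A, a y ∈ c.source → 0 < (fderiv ℝ (c ∘ a) y).det)
    {E : Set (Euc d)} (hE : MeasurableSet E)
    (hinj : InjOn (fun y => c (ρ (a y))) (coordPreimage Ω ρ c E a A))
    (hint : IntegrableOn (TopForm.density c.symm η) E) :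
    MeasurableSet ((fun y => c (ρ (a y))) '' coordPreimage Ω ρ c E a A) ∧
    IntegrableOn (TopForm.density a η) (coordPreimage Ω ρ c E a A) ∧
    ∫ y in coordPreimage Ω ρ c E a A, TopForm.density a η y =
      ∫ y in (fun y => c (ρ (a y))) '' coordPreimage Ω ρ c E a A, TopForm.density c.symm η y := by
  set S := coordPreimage Ω ρ c E a A with hS
  have hSm : MeasurableSet S := measurableSet_coordPreimage hρ hE hA ha.continuousOn
  have key : ∀ y ∈ S, ∃ L : Euc d →L[ℝ] Euc d,
      HasFDerivWithinAt (fun y => c (ρ (a y))) L S y ∧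
      TopForm.density a η y = |L.det| • TopForm.density c.symm η (c (ρ (a y))) := by
    intro y hy
    obtain ⟨V, g, hV, hyV, hg, hgc, hdet, hdens⟩ :=
      hρ.exists_local_extension hη hc hA ha hopen hor hy.1 hy.2.1 hy.2.2.1
    refine ⟨fderiv ℝ g y, ?_, ?_⟩
    · have h1 : HasFDerivAt g (fderiv ℝ g y) y :=
        ((hg.contDiffAt (hV.mem_nhds hyV)).differentiableAt (by simp)).hasFDerivAt
      refine h1.hasFDerivWithinAt.congr_of_eventuallyEq ?_ (hgc y hyV hy.2.1).symm
      filter_upwards [self_mem_nhdsWithin, mem_nhdsWithin_of_mem_nhds (hV.mem_nhds hyV)]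
        with z hz hzV using (hgc z hzV hz.2.1).symm
    · rw [hdens, abs_of_nonneg hdet, hgc y hyV hy.2.1, smul_eq_mul]
  choose! L hL hLd using key
  have hsub : (fun y => c (ρ (a y))) '' S ⊆ E := by
    rintro _ ⟨y, hy, rfl⟩
    exact hy.2.2.2
  refine ⟨measurable_image_of_fderivWithin hSm hL hinj, ?_, ?_⟩
  · rw [integrableOn_congr_fun hLd hSm]
    exact (integrableOn_image_iff_integrableOn_abs_det_fderiv_smul volume hSm hL hinj _).1
      (hint.mono_set hsub)
  · rw [integral_image_eq_integral_abs_det_fderiv_smul volume hSm hL hinj]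
    exact setIntegral_congr_fun hSm hLd

/-- The frontier of a domain of integration contributes a null set to each chart. -/
theorem IsSmoothRetraction.volume_image_frontier [IsManifold 𝓘(ℝ, Euc d) ∞ X]
    {Ω : Set X} {ρ : X → X} (hρ : IsSmoothRetraction d Ω ρ)
    {c : OpenPartialHomeomorph X (Euc d)}
    (hc : c ∈ IsManifold.maximalAtlas 𝓘(ℝ, Euc d) ∞ X)
    {a : Euc d → X} {A : Set (Euc d)} (ha : SmoothOnSet d a (closure A))
    (hA : volume (frontier A) = 0) (E : Set (Euc d)) :
    volume ((fun y => c (ρ (a y))) '' coordPreimage Ω ρ c E a (frontier A)) = 0 := by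
  apply addHaar_image_eq_zero_of_differentiableOn_of_addHaar_eq_zero
  swap
  · exact measure_mono_null (fun y hy => hy.1) hA
  intro y hy
  obtain ⟨V₁, a', hV₁, hyV₁, ha', hea⟩ := ha y (frontier_subset_closure hy.1)
  obtain ⟨V₀, h, hV₀, hyV₀, hh, he⟩ := hρ.smooth _ hy.2.1
  have hay : a' y = a y := hea ⟨frontier_subset_closure hy.1, hyV₁⟩
  have h1 : MDifferentiableAt 𝓘(ℝ, Euc d) 𝓘(ℝ, Euc d) a' y :=
    (ha'.contMDiffAt (hV₁.mem_nhds hyV₁)).mdifferentiableAt (by simp)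
  have h2 : MDifferentiableAt 𝓘(ℝ, Euc d) 𝓘(ℝ, Euc d) h (a' y) :=
    (hh.contMDiffAt (hV₀.mem_nhds (by rwa [hay]))).mdifferentiableAt (by simp)
  have h3 : MDifferentiableAt 𝓘(ℝ, Euc d) 𝓘(ℝ, Euc d) c (h (a' y)) := by
    refine (contMDiffAt_of_mem_maximalAtlas hc ?_).mdifferentiableAt (by simp)
    rw [hay, he ⟨hy.2.1, hyV₀⟩]
    exact hy.2.2.1
  have h4 : DifferentiableAt ℝ (c ∘ (h ∘ a')) y :=
    mdifferentiableAt_iff_differentiableAt.1 (h3.comp y (h2.comp y h1))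
  refine h4.differentiableWithinAt.congr_of_eventuallyEq ?_ ?_
  · filter_upwards [self_mem_nhdsWithin, mem_nhdsWithin_of_mem_nhds (hV₁.mem_nhds hyV₁),
      mem_nhdsWithin_of_mem_nhds (h1.continuousAt (hV₀.mem_nhds (by rwa [hay])))] with z hz hz1 hz0
    have e1 : a' z = a z := hea ⟨frontier_subset_closure hz.1, hz1⟩
    have e2 : h (a z) = ρ (a z) := he ⟨hz.2.1, by rw [← e1]; exact hz0⟩
    simp [e1, e2]
  · have e2 : h (a y) = ρ (a y) := he ⟨hy.2.1, hyV₀⟩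
    simp [hay, e2]

end NonSep

/-- A limit of values of `a` on a bounded set `A` is not separated from a value of `a` on the
closure of `A`. -/
theorem exists_nonSep_of_mem_closure_image {d : ℕ} {X : Type*} [TopologicalSpace X]
    {a : Euc d → X} {A : Set (Euc d)}
    (hA : Bornology.IsBounded A) (ha : ContinuousOn a (closure A)) {x : X}
    (hx : x ∈ closure (a '' A)) : ∃ z ∈ closure A, NonSep (a z) x := by
  have hne : (Filter.comap a (𝓝 x) ⊓ Filter.principal A).NeBot := by
    rw [Filter.neBot_iff, Ne, ← _root_.disjoint_iff, Filter.disjoint_principal_right,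
      Filter.mem_comap]
    rintro ⟨t, ht, hts⟩
    obtain ⟨w, hw, z, hz, rfl⟩ := mem_closure_iff_nhds.1 hx t ht
    exact hts hw hz
  set F := Ultrafilter.of (Filter.comap a (𝓝 x) ⊓ Filter.principal A)
  have hF : (F : Filter (Euc d)) ≤ Filter.comap a (𝓝 x) ⊓ Filter.principal A :=
    Ultrafilter.of_le _
  have hF1 : Filter.Tendsto a F (𝓝 x) :=
    Filter.tendsto_iff_comap.2 (hF.trans inf_le_left)
  have hF2 : (F : Filter (Euc d)) ≤ Filter.principal (closure A) :=
    (hF.trans inf_le_right).trans (Filter.principal_mono.2 subset_closure)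
  obtain ⟨z, hz, hFz⟩ := hA.isCompact_closure.ultrafilter_le_nhds F hF2
  refine ⟨z, hz, ?_⟩
  have h3 : Filter.Tendsto a F (𝓝 (a z)) := (ha z hz).mono_left (le_inf hFz hF2)
  exact Filter.NeBot.mono (inferInstanceAs (Filter.map a F).NeBot) (le_inf h3 hF1)

/-! ### The value of a parametrisation -/

section Value

variable {d : ℕ} {X : Type*} [TopologicalSpace X] [ChartedSpace (Euc d) X]

theorem setIntegral_eq_sum_of_ae_cover {ι : Type*} [Fintype ι] {f : Euc d → ℝ} {A : Set (Euc d)}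
    (hA : MeasurableSet A) {S : ι → Set (Euc d)} (hS : ∀ i, MeasurableSet (S i))
    (hSA : ∀ i, S i ⊆ A) (hd : Pairwise (Function.onFun Disjoint S))
    (hi : ∀ i, IntegrableOn f (S i))
    {N : Set (Euc d)} (hN : volume N = 0) (hc : ∀ y ∈ A, f y ≠ 0 → y ∉ N → ∃ i, y ∈ S i) :
    ∫ y in A, f y = ∑ i, ∫ y in S i, f y := by
  rw [← integral_iUnion_fintype hS hd hi]
  refine setIntegral_eq_of_subset_of_ae_sdiff_eq_zero hA.nullMeasurableSet (iUnion_subset hSA) ?_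
  filter_upwards [measure_eq_zero_iff_ae_notMem.1 hN] with y hy hyA
  by_contra h
  exact hyA.2 (mem_iUnion.2 (hc y hyA.1 h hy))

namespace Parametrisation

variable {𝒪 : Set (OpenPartialHomeomorph X (Euc d))} {K : Set X} {η : TopForm d X}
  (P : Parametrisation 𝒪 K η)

theorem contMDiffOn (α : Fin P.num) :
    ContMDiffOn 𝓘(ℝ, Euc d) 𝓘(ℝ, Euc d) ∞ (P.a α) (P.A α) :=
  (P.smooth α).contMDiffOn (P.isOpen_dom α) subset_closure

theorem isOpen_image_of_subset (α : Fin P.num) (V : Set (Euc d)) (hVA : V ⊆ P.A α)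
    (hV : IsOpen V) : IsOpen (P.a α '' V) := by
  obtain ⟨b, hb, hba⟩ := P.smooth_inv α
  have : P.a α '' V = P.a α '' P.A α ∩ b ⁻¹' V := by
    ext x
    constructor
    · rintro ⟨y, hy, rfl⟩
      exact ⟨mem_image_of_mem _ (hVA hy), by rwa [mem_preimage, hba y (hVA hy)]⟩
    · rintro ⟨⟨y, hy, rfl⟩, hyV⟩
      rw [mem_preimage, hba y hy] at hyV
      exact mem_image_of_mem _ hyV
  rw [this]
  exact hb.continuousOn.isOpen_inter_preimage (P.isOpen_image α) hV

/-- Distinct points in the images of a parametrisation are separated. -/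
theorem eq_of_nonSep {α β : Fin P.num} {y z : Euc d} (hy : y ∈ P.A α) (hz : z ∈ P.A β)
    (h : NonSep (P.a α y) (P.a β z)) : α = β ∧ y = z := by
  have hαβ : α = β := by
    by_contra hne
    obtain ⟨x, hx, hx'⟩ := h.nonempty_inter (P.isOpen_image α) (mem_image_of_mem _ hy)
      (P.isOpen_image β) (mem_image_of_mem _ hz)
    exact (P.disjoint α β hne).le_bot ⟨hx, hx'⟩
  subst hαβ
  refine ⟨rfl, ?_⟩
  by_contra hne
  obtain ⟨V, W, hV, hW, hyV, hzW, hVW⟩ := t2_separation hne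
  obtain ⟨x, ⟨v, hv, rfl⟩, ⟨w, hw, hvw⟩⟩ := h.nonempty_inter
    (P.isOpen_image_of_subset α _ inter_subset_left ((P.isOpen_dom α).inter hV))
    (mem_image_of_mem _ ⟨hy, hyV⟩)
    (P.isOpen_image_of_subset α _ inter_subset_left ((P.isOpen_dom α).inter hW))
    (mem_image_of_mem _ ⟨hz, hzW⟩)
  obtain ⟨b, -, hb⟩ := P.smooth_inv α
  have : v = w := by rw [← hb v hv.1, ← hb w hw.1, hvw]
  exact hVW.le_bot ⟨hv.2, this ▸ hw.2⟩

theorem det_pos {α : Fin P.num} {c : OpenPartialHomeomorph X (Euc d)} (hc : c ∈ 𝒪) {y : Euc d}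
    (hy : y ∈ P.A α) (hyc : P.a α y ∈ c.source) : 0 < (fderiv ℝ (c ∘ P.a α) y).det :=
  P.orientation α y hy _ rfl (mem_univ _) c hc hyc

/-- Every parametrisation of `K` has the same value, namely the integral over any system of
representatives for non-separation of the support of `η` in `K`: a finite family of measurable
sets `E l` in the coordinates of oriented charts `c l`, such that distinct points of the `E l`
are separated, and each point of `K` at which `η` does not vanish is not separated from one of
them. Both integrals are split according to which `A α` and which `E l` a point represents, and
the pieces are compared by the maps `c l ∘ ρ l ∘ a α`. -/
theorem value_eq_sum_integral [IsManifold 𝓘(ℝ, Euc d) ∞ X] (hη : η.IsContinuous)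
    (htrans : ∀ x y z : X, NonSep x y → NonSep y z → NonSep x z)
    {ι : Type*} [Fintype ι] {c : ι → OpenPartialHomeomorph X (Euc d)}
    (hcO : ∀ l, c l ∈ 𝒪) (hc : ∀ l, c l ∈ IsManifold.maximalAtlas 𝓘(ℝ, Euc d) ∞ X)
    {Ω : ι → Set X} {ρ : ι → X → X} (hρ : ∀ l, IsSmoothRetraction d (Ω l) (ρ l))
    (hsrc : ∀ l, (c l).source ⊆ Ω l) {E : ι → Set (Euc d)}
    (hE : ∀ l, MeasurableSet (E l)) (hEt : ∀ l, E l ⊆ (c l).target)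
    (hint : ∀ l, IntegrableOn (TopForm.density (c l).symm η) (E l))
    (hinj : ∀ l l' y y', y ∈ E l → y' ∈ E l' → NonSep ((c l).symm y) ((c l').symm y') →
      l = l' ∧ y = y')
    (hcov : ∀ x ∈ K, η x ≠ 0 → ∃ l, ∃ y ∈ E l, NonSep x ((c l).symm y))
    (hsub : ∀ l, ∀ y ∈ E l, (c l).symm y ∈ K) :
    P.value = ∑ l, ∫ y in E l, TopForm.density (c l).symm η y := by
  set S : Fin P.num → ι → Set (Euc d) := fun α l =>
    coordPreimage (Ω l) (ρ l) (c l) (E l) (P.a α) (P.A α) with hS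
  set T : Fin P.num → ι → Euc d → Euc d := fun α l y => c l (ρ l (P.a α y)) with hT
  -- the point represented by `y ∈ S α l` is not separated from the point with coordinates `T y`
  have hrel : ∀ α l (A : Set (Euc d)), ∀ y ∈ coordPreimage (Ω l) (ρ l) (c l) (E l) (P.a α) A,
      NonSep (P.a α y) ((c l).symm (T α l y)) := by
    intro α l A y hy
    rw [hT, (c l).left_inv hy.2.2.1]
    exact (hρ l).nonSep _ hy.2.1
  -- conversely, non-separated points are related in this way
  have hmem : ∀ α l (A : Set (Euc d)), ∀ y ∈ A, ∀ z ∈ E l, NonSep (P.a α y) ((c l).symm z) →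
      y ∈ coordPreimage (Ω l) (ρ l) (c l) (E l) (P.a α) A ∧ T α l y = z := by
    intro α l A y hy z hz h
    have hzs : (c l).symm z ∈ (c l).source := (c l).map_target (hEt l hz)
    have hcl : P.a α y ∈ closure (Ω l) := h.mem_closure (hρ l).isOpen (hsrc l hzs)
    have hu : (c l).symm z = ρ l (P.a α y) := (hρ l).unique _ hcl _ (hsrc l hzs) h
    have hz' : c l (ρ l (P.a α y)) = z := by rw [← hu, (c l).right_inv (hEt l hz)]
    exact ⟨⟨hy, hcl, hu ▸ hzs, hz'.symm ▸ hz⟩, hz'⟩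
  have hTinj : ∀ α β l, ∀ y ∈ S α l, ∀ z ∈ S β l, T α l y = T β l z → α = β ∧ y = z := by
    intro α β l y hy z hz h
    refine P.eq_of_nonSep hy.1 hz.1 (htrans _ _ _ (hrel α l _ y hy) ?_)
    rw [h]
    exact (hrel β l _ z hz).symm
  have hcv := fun α l => (hρ l).integral_coordPreimage hη (hc l) (P.isOpen_dom α)
    (P.contMDiffOn α) (P.isOpen_image_of_subset α) (fun y hy h => P.det_pos (hcO l) hy h) (hE l)
    (fun y hy z hz h => (hTinj α α l y hy z hz h).2) (hint l)
  have h1 : ∀ α, ∫ y in P.A α, TopForm.density (P.a α) η y =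
      ∑ l, ∫ y in S α l, TopForm.density (P.a α) η y := by
    intro α
    refine setIntegral_eq_sum_of_ae_cover (P.isOpen_dom α).measurableSet
      (fun l => measurableSet_coordPreimage (hρ l) (hE l) (P.isOpen_dom α)
        (P.contMDiffOn α).continuousOn) (fun l y hy => hy.1) ?_ (fun l => (hcv α l).2.1)
      measure_empty ?_
    · intro l l' hll
      rw [Function.onFun, Set.disjoint_left]
      intro y hy hy'
      exact hll (hinj l l' _ _ hy.2.2.2 hy'.2.2.2
        (htrans _ _ _ (hrel α l _ y hy).symm (hrel α l' _ y hy'))).1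
    · intro y hy hne _
      obtain ⟨l, z, hz, hzy⟩ := hcov _ (P.image_subset α (mem_image_of_mem _ hy))
        (TopForm.ne_zero_of_density_ne_zero hne)
      exact ⟨l, (hmem α l _ y hy z hz hzy).1⟩
  have h2 : ∀ l, ∫ y in E l, TopForm.density (c l).symm η y =
      ∑ α, ∫ y in T α l '' S α l, TopForm.density (c l).symm η y := by
    intro l
    refine setIntegral_eq_sum_of_ae_cover (hE l) (fun α => (hcv α l).1) ?_ ?_ ?_
      (N := ⋃ α, T α l '' coordPreimage (Ω l) (ρ l) (c l) (E l) (P.a α) (frontier (P.A α))) ?_ ?_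
    · rintro α _ ⟨y, hy, rfl⟩
      exact hy.2.2.2
    · intro α β hαβ
      rw [Function.onFun, Set.disjoint_left]
      rintro _ ⟨y, hy, rfl⟩ ⟨z, hz, hyz⟩
      exact hαβ (hTinj α β l y hy z hz hyz.symm).1
    · intro α
      refine (hint l).mono_set ?_
      rintro _ ⟨y, hy, rfl⟩
      exact hy.2.2.2
    · exact measure_iUnion_null fun α =>
        (hρ l).volume_image_frontier (hc l) (P.smooth α) (P.null_frontier α) (E l)
    · intro z hz hne hN
      have hsupp : (c l).symm z ∈ η.supportOn K :=
        subset_closure ⟨hsub l z hz, TopForm.ne_zero_of_density_ne_zero hne⟩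
      obtain ⟨α, hα⟩ := mem_iUnion.1 (P.cover hsupp)
      obtain ⟨y, hy, hyz⟩ := exists_nonSep_of_mem_closure_image (P.isBounded_dom α)
        (P.smooth α).continuousOn hα
      by_cases hyA : y ∈ P.A α
      · obtain ⟨h3, h4⟩ := hmem α l _ y hyA z hz hyz
        exact ⟨α, y, h3, h4⟩
      · refine absurd (mem_iUnion.2 ⟨α, ?_⟩) hN
        obtain ⟨h3, h4⟩ := hmem α l (frontier (P.A α)) y
          (by rw [(P.isOpen_dom α).frontier_eq]; exact ⟨hy, hyA⟩) z hz hyz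
        exact ⟨y, h3, h4⟩
  calc P.value = ∑ α, ∑ l, ∫ y in S α l, TopForm.density (P.a α) η y :=
        Finset.sum_congr rfl fun α _ => h1 α
    _ = ∑ l, ∑ α, ∫ y in S α l, TopForm.density (P.a α) η y := Finset.sum_comm
    _ = _ := Finset.sum_congr rfl fun l _ => by
        rw [h2 l]
        exact Finset.sum_congr rfl fun α _ => (hcv α l).2.2

end Parametrisation

end Value

/-! ### Null sets in a manifold -/

section Null

variable {d : ℕ} {X : Type*} [TopologicalSpace X] [ChartedSpace (Euc d) X]

/-- A subset of a manifold is null when its expression in each smooth chart is. -/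
def IsNullSet (d : ℕ) {X : Type*} [TopologicalSpace X] [ChartedSpace (Euc d) X]
    (N : Set X) : Prop :=
  ∀ e ∈ IsManifold.maximalAtlas 𝓘(ℝ, Euc d) ∞ X, volume (e.target ∩ e.symm ⁻¹' N) = 0

theorem IsNullSet.mono {N N' : Set X} (h : IsNullSet d N') (hN : N ⊆ N') : IsNullSet d N :=
  fun e he => measure_mono_null (inter_subset_inter_right _ (preimage_mono hN)) (h e he)

theorem IsNullSet.iUnion {ι : Type*} [Countable ι] {N : ι → Set X} (h : ∀ i, IsNullSet d (N i)) :
    IsNullSet d (⋃ i, N i) := by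
  intro e he
  rw [preimage_iUnion, inter_iUnion]
  exact measure_iUnion_null fun i => h i e he

theorem IsNullSet.union {N N' : Set X} (h : IsNullSet d N) (h' : IsNullSet d N') :
    IsNullSet d (N ∪ N') := by
  intro e he
  rw [preimage_union, inter_union_distrib_left]
  exact measure_union_null (h e he) (h' e he)

/-- It suffices to find, around each point, one chart in which the set is null: smooth transition
maps preserve null sets, and Euclidean space is second countable. -/
theorem IsNullSet.of_forall_exists_chart [IsManifold 𝓘(ℝ, Euc d) ∞ X] {N : Set X}
    (h : ∀ p ∈ N, ∃ e ∈ IsManifold.maximalAtlas 𝓘(ℝ, Euc d) ∞ X,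
      p ∈ e.source ∧ volume (e.target ∩ e.symm ⁻¹' N) = 0) : IsNullSet d N := by
  intro e' he'
  refine measure_null_of_locally_null _ fun z hz => ?_
  obtain ⟨e, he, hpe, hv⟩ := h _ hz.2
  have ho : IsOpen (e'.target ∩ e'.symm ⁻¹' e.source) :=
    e'.isOpen_inter_preimage_symm e.open_source
  refine ⟨(e'.target ∩ e'.symm ⁻¹' N) ∩ (e'.target ∩ e'.symm ⁻¹' e.source),
    Filter.inter_mem self_mem_nhdsWithin (mem_nhdsWithin_of_mem_nhds (ho.mem_nhds ⟨hz.1, hpe⟩)), ?_⟩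
  set s := (e.target ∩ e.symm ⁻¹' N) ∩ (e.target ∩ e.symm ⁻¹' e'.source) with hs
  have hd : DifferentiableOn ℝ (e' ∘ e.symm) s := by
    intro w hw
    have h1 : MDifferentiableAt 𝓘(ℝ, Euc d) 𝓘(ℝ, Euc d) e.symm w :=
      (contMDiffAt_symm_of_mem_maximalAtlas he hw.1.1).mdifferentiableAt (by simp)
    have h2 : MDifferentiableAt 𝓘(ℝ, Euc d) 𝓘(ℝ, Euc d) e' (e.symm w) :=
      (contMDiffAt_of_mem_maximalAtlas he' hw.2.2).mdifferentiableAt (by simp)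
    exact (mdifferentiableAt_iff_differentiableAt.1 (h2.comp w h1)).differentiableWithinAt
  refine measure_mono_null ?_ (addHaar_image_eq_zero_of_differentiableOn_of_addHaar_eq_zero
    volume hd (measure_mono_null inter_subset_left hv))
  rintro w ⟨⟨hw1, hw2⟩, -, hw3⟩
  have hl : e.symm (e (e'.symm w)) = e'.symm w := e.left_inv hw3
  refine ⟨e (e'.symm w), ⟨⟨e.map_source hw3, ?_⟩, e.map_source hw3, ?_⟩, ?_⟩
  · rw [mem_preimage, hl]; exact hw2
  · rw [mem_preimage, hl]; exact e'.map_target hw1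
  · rw [Function.comp_apply, hl, e'.right_inv hw1]

theorem IsNullSet.eq_empty_of_isOpen [IsManifold 𝓘(ℝ, Euc d) ∞ X] {V : Set X}
    (h : IsNullSet d V) (hV : IsOpen V) : V = ∅ := by
  by_contra hne
  obtain ⟨x, hx⟩ := nonempty_iff_ne_empty.2 hne
  have h1 := h _ (IsManifold.chart_mem_maximalAtlas x)
  refine ((chartAt (Euc d) x).isOpen_inter_preimage_symm hV).measure_ne_zero volume ?_ h1
  refine ⟨chartAt (Euc d) x x, mem_chart_target _ _, ?_⟩
  rw [mem_preimage, (chartAt (Euc d) x).left_inv (mem_chart_source _ _)]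
  exact hx

theorem volume_setOf_apply_eq_zero (k : Fin d) : volume {y : Euc d | y k = 0} = 0 := by
  have h := Measure.addHaar_submodule (volume : Measure (Euc d))
    (LinearMap.ker (EuclideanSpace.proj k : Euc d →L[ℝ] ℝ).toLinearMap) ?_
  · convert h using 2
    ext y
    simp
  · intro h
    have : EuclideanSpace.single k (1 : ℝ) ∈
      LinearMap.ker (EuclideanSpace.proj k : Euc d →L[ℝ] ℝ).toLinearMap := h ▸ Submodule.mem_top
    simp at this

theorem IsRegularDomain.isNullSet_frontier [IsManifold 𝓘(ℝ, Euc d) ∞ X] {D : Set X}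
    (hD : IsRegularDomain d D) : IsNullSet d (frontier D) := by
  refine IsNullSet.of_forall_exists_chart fun p hp => ?_
  obtain ⟨e, he, hpe, k, hk⟩ := hD.halfSpace p hp
  refine ⟨e, he, hpe, measure_mono_null ?_ (volume_setOf_apply_eq_zero k)⟩
  rintro z ⟨hz, hzf⟩
  have hzs : e.symm z ∈ e.source := e.map_target hz
  have hcont : ContinuousAt (fun q => e q k) (e.symm z) := by
    have h1 : Continuous (fun y : Euc d => y k) := by fun_prop
    exact ContinuousAt.comp (f := e) h1.continuousAt (e.continuousAt hzs)
  have hez : e (e.symm z) k = z k := by rw [e.right_inv hz]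
  rcases lt_trichotomy (z k) 0 with h | h | h
  · exfalso
    have h2 : Dᶜ ∈ 𝓝 (e.symm z) := by
      filter_upwards [hcont.eventually_lt continuousAt_const (by simpa [hez] using h),
        e.open_source.mem_nhds hzs] with q hq hqs hqD
      exact absurd ((hk q hqs).1 hqD) (not_le.2 hq)
    obtain ⟨q, hq, hq'⟩ := mem_closure_iff_nhds.1 hzf.1 _ h2
    exact hq hq'
  · exact h
  · refine absurd (mem_interior_iff_mem_nhds.2 ?_) hzf.2
    filter_upwards [continuousAt_const.eventually_lt hcont (by simpa [hez] using h),
      e.open_source.mem_nhds hzs] with q hq hqs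
    exact (hk q hqs).2 hq.le

end Null

/-! ### Parametrisations by pieces of charts -/

section BallCover

variable {d : ℕ} {X : Type*} [TopologicalSpace X]

/-- A finite family of closed balls in charts from `𝒪`, the images of whose interiors cover `S`. -/
structure BallCover (𝒪 : Set (OpenPartialHomeomorph X (Euc d))) (S : Set X) where
  num : ℕ
  e : Fin num → OpenPartialHomeomorph X (Euc d)
  center : Fin num → Euc d
  radius : Fin num → ℝ
  mem : ∀ l, e l ∈ 𝒪
  radius_pos : ∀ l, 0 < radius l
  closedBall_subset : ∀ l, Metric.closedBall (center l) (radius l) ⊆ (e l).target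
  cover : S ⊆ ⋃ l, (e l).symm '' Metric.ball (center l) (radius l)

namespace BallCover

variable {𝒪 : Set (OpenPartialHomeomorph X (Euc d))} {S : Set X} (B : BallCover 𝒪 S)

/-- The image in `X` of the `l`-th open ball. -/
def oball (l : Fin B.num) : Set X := (B.e l).symm '' Metric.ball (B.center l) (B.radius l)

/-- The image in `X` of the `l`-th closed ball. -/
def cball (l : Fin B.num) : Set X := (B.e l).symm '' Metric.closedBall (B.center l) (B.radius l)

/-- The points of the `l`-th closed ball outside all the preceding closed balls. The pieces are
disjoint, and cover `S`. -/
def piece (l : Fin B.num) : Set X := B.cball l \ ⋃ l' < l, B.cball l'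

/-- The points of the `l`-th open ball outside all the preceding closed balls. The cells are
disjoint and open, and their union is dense in the union of the balls. -/
def cell (l : Fin B.num) : Set X := B.oball l \ ⋃ l' < l, B.cball l'

theorem oball_subset_cball (l : Fin B.num) : B.oball l ⊆ B.cball l :=
  image_mono Metric.ball_subset_closedBall

theorem isOpen_oball (l : Fin B.num) : IsOpen (B.oball l) :=
  (B.e l).symm.isOpen_image_of_subset_source Metric.isOpen_ball
    (Metric.ball_subset_closedBall.trans (B.closedBall_subset l))

theorem isClosed_cball [T2Space X] (l : Fin B.num) : IsClosed (B.cball l) :=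
  ((isCompact_closedBall _ _).image_of_continuousOn
    ((B.e l).continuousOn_symm.mono (B.closedBall_subset l))).isClosed

theorem isClosed_preceding [T2Space X] (l : Fin B.num) : IsClosed (⋃ l' < l, B.cball l') :=
  (Set.toFinite {l' | l' < l}).isClosed_biUnion fun l' _ => B.isClosed_cball l'

theorem isOpen_cell [T2Space X] (l : Fin B.num) : IsOpen (B.cell l) :=
  (B.isOpen_oball l).sdiff (B.isClosed_preceding l)

theorem disjoint_piece {l l' : Fin B.num} (h : l ≠ l') : Disjoint (B.piece l) (B.piece l') := by
  rw [Set.disjoint_left]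
  rintro x hx hx'
  rcases lt_or_gt_of_ne h with h | h
  · exact hx'.2 (mem_iUnion₂.2 ⟨l, h, hx.1⟩)
  · exact hx.2 (mem_iUnion₂.2 ⟨l', h, hx'.1⟩)

theorem cell_subset_piece (l : Fin B.num) : B.cell l ⊆ B.piece l :=
  fun _ hx => ⟨B.oball_subset_cball l hx.1, hx.2⟩

theorem exists_mem_piece {x : X} (hx : x ∈ S) : ∃ l, x ∈ B.piece l := by
  classical
  obtain ⟨l, hl⟩ := mem_iUnion.1 (B.cover hx)
  have hne : (Finset.univ.filter fun l => x ∈ B.cball l).Nonempty :=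
    ⟨l, by simpa using B.oball_subset_cball l hl⟩
  obtain ⟨m, hm, hmin⟩ := Finset.exists_min_image _ id hne
  refine ⟨m, by simpa using hm, ?_⟩
  intro h
  obtain ⟨l', hl', hx'⟩ := mem_iUnion₂.1 h
  exact absurd (hmin l' (by simpa using hx')) (not_le.2 hl')

theorem frontier_cell_subset [T2Space X] (l : Fin B.num) :
    frontier (B.cell l) ⊆ ⋃ l', B.cball l' \ B.oball l' := by
  intro x hx
  rw [(B.isOpen_cell l).frontier_eq] at hx
  have h1 : x ∈ B.cball l := (B.isClosed_cball l).closure_subset_iff.2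
    (fun y hy => B.oball_subset_cball l hy.1) hx.1
  by_contra hn
  simp only [mem_iUnion, mem_sdiff, not_exists, not_and, not_not] at hn
  refine hx.2 ⟨hn l h1, fun h => ?_⟩
  obtain ⟨l', hl', hxl'⟩ := mem_iUnion₂.1 h
  obtain ⟨y, hy, hyc⟩ := mem_closure_iff.1 hx.1 _ (B.isOpen_oball l') (hn l' hxl')
  exact hyc.2 (mem_iUnion₂.2 ⟨l', hl', B.oball_subset_cball l' hy⟩)

/-- The part of the `l`-th cell inside `D`, in coordinates. -/
def coordCell (D : Set X) (l : Fin B.num) : Set (Euc d) :=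
  (B.e l).target ∩ (B.e l).symm ⁻¹' (B.cell l ∩ D)

theorem image_coordCell (D : Set X) (l : Fin B.num) :
    (B.e l).symm '' B.coordCell D l = B.cell l ∩ D := by
  ext x
  constructor
  · rintro ⟨y, hy, rfl⟩
    exact hy.2
  · intro hx
    obtain ⟨y, hy, rfl⟩ := hx.1.1
    exact ⟨y, ⟨B.closedBall_subset l (Metric.ball_subset_closedBall hy), hx⟩, rfl⟩

theorem coordCell_subset (D : Set X) (l : Fin B.num) :
    B.coordCell D l ⊆ Metric.closedBall (B.center l) (B.radius l) := by
  rintro y ⟨hy, hyc, -⟩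
  obtain ⟨w, hw, hwy⟩ := hyc.1
  have hw' := Metric.ball_subset_closedBall hw
  rwa [← (B.e l).symm.injOn (B.closedBall_subset l hw') hy hwy]

theorem isOpen_coordCell [T2Space X] {D : Set X} (hD : IsOpen D) (l : Fin B.num) :
    IsOpen (B.coordCell D l) :=
  (B.e l).isOpen_inter_preimage_symm ((B.isOpen_cell l).inter hD)

theorem closure_coordCell_subset (D : Set X) (l : Fin B.num) :
    closure (B.coordCell D l) ⊆ (B.e l).target :=
  (Metric.isClosed_closedBall.closure_subset_iff.2 (B.coordCell_subset D l)).trans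
    (B.closedBall_subset l)

/-- The part of the `l`-th piece inside `K`, in coordinates. -/
def coordPiece (K : Set X) (l : Fin B.num) : Set (Euc d) :=
  Metric.closedBall (B.center l) (B.radius l) ∩ (B.e l).symm ⁻¹' (B.piece l ∩ K)

theorem measurableSet_coordPiece [T2Space X] {K : Set X} (hK : MeasurableSet[borel X] K)
    (l : Fin B.num) : MeasurableSet (B.coordPiece K l) := by
  let _ : MeasurableSpace X := borel X
  have : BorelSpace X := ⟨rfl⟩
  have h1 : MeasurableSet (B.piece l) :=
    (B.isClosed_cball l).measurableSet.diff (B.isClosed_preceding l).measurableSet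
  exact measurableSet_preimage_of_continuousOn
    ((B.e l).continuousOn_symm.mono (B.closedBall_subset l)) measurableSet_closedBall (h1.inter hK)

theorem coordPiece_subset_target (K : Set X) (l : Fin B.num) :
    B.coordPiece K l ⊆ (B.e l).target :=
  inter_subset_left.trans (B.closedBall_subset l)

theorem exists_mem_coordPiece {K : Set X} {x : X} (hx : x ∈ S) (hxK : x ∈ K) :
    ∃ l, ∃ y ∈ B.coordPiece K l, (B.e l).symm y = x := by
  obtain ⟨l, hl⟩ := B.exists_mem_piece hx
  obtain ⟨y, hy, rfl⟩ := hl.1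
  exact ⟨l, y, ⟨hy, hl, hxK⟩, rfl⟩

theorem eq_of_mem_coordPiece {K : Set X} {l l' : Fin B.num} {y y' : Euc d}
    (hy : y ∈ B.coordPiece K l) (hy' : y' ∈ B.coordPiece K l')
    (h : (B.e l).symm y = (B.e l').symm y') : l = l' ∧ y = y' := by
  have hl : l = l' := by
    by_contra hne
    exact (B.disjoint_piece hne).le_bot ⟨hy.2.1, by rw [h]; exact hy'.2.1⟩
  subst hl
  exact ⟨rfl, (B.e l).symm.injOn (B.coordPiece_subset_target K l hy)
    (B.coordPiece_subset_target K l hy') h⟩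

end BallCover

variable [ChartedSpace (Euc d) X]

/-- Existence of parametrisations: disjoint open subsets of `K` inside oriented charts whose
closures cover the support. -/
theorem Parametrisation.nonempty_of_charts [IsManifold 𝓘(ℝ, Euc d) ∞ X]
    {𝒪 : Set (OpenPartialHomeomorph X (Euc d))} (h𝒪 : IsOrientedAtlas 𝒪) {K : Set X}
    {η : TopForm d X} {ι : Type*} [Fintype ι] {c : ι → OpenPartialHomeomorph X (Euc d)}
    (hc : ∀ l, c l ∈ 𝒪) {W : ι → Set (Euc d)} (hW : ∀ l, IsOpen (W l))
    (hWb : ∀ l, Bornology.IsBounded (W l)) (hWc : ∀ l, closure (W l) ⊆ (c l).target)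
    (hWn : ∀ l, volume (frontier (W l)) = 0) (hWK : ∀ l, (c l).symm '' W l ⊆ K)
    (hWd : ∀ l l', l ≠ l' → Disjoint ((c l).symm '' W l) ((c l').symm '' W l'))
    (hcov : η.supportOn K ⊆ ⋃ l, closure ((c l).symm '' W l)) :
    Nonempty (Parametrisation 𝒪 K η) := by
  set q := (Fintype.equivFin ι).symm
  have hsub : ∀ l, W l ⊆ (c l).target := fun l => subset_closure.trans (hWc l)
  have ho : ∀ l, IsOpen ((c l).symm '' W l) := fun l =>
    (c l).symm.isOpen_image_of_subset_source (hW l) (hsub l)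
  exact ⟨{
    num := Fintype.card ι
    A := fun α => W (q α)
    a := fun α => (c (q α)).symm
    isOpen_dom := fun α => hW _
    isBounded_dom := fun α => hWb _
    null_frontier := fun α => hWn _
    smooth := fun α y hy => ⟨(c (q α)).target, (c (q α)).symm, (c (q α)).open_target,
      hWc _ hy, contMDiffOn_symm_of_mem_maximalAtlas (h𝒪.subset (hc _)), fun _ _ => rfl⟩
    isOpen_image := fun α => ho _
    smooth_inv := fun α => ⟨c (q α), (contMDiffOn_of_mem_maximalAtlas (h𝒪.subset (hc _))).mono (by
        rintro _ ⟨y, hy, rfl⟩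
        exact (c (q α)).map_target (hsub _ hy)), fun y hy => (c (q α)).right_inv (hsub _ hy)⟩
    orientation := by
      intro α y hy e he hye e' he' hye'
      have h1 := h𝒪.compat _ (mem_univ ((c (q α)).symm y)) _ (hc (q α))
        ((c (q α)).map_target (hsub _ hy)) e' he' hye'
      rw [(c (q α)).right_inv (hsub _ hy)] at h1
      rw [mem_singleton_iff.1 he]
      exact h1
    image_subset := fun α => hWK _
    disjoint := fun α β hαβ => hWd _ _ (q.injective.ne hαβ)
    cover := hcov.trans (iUnion_subset fun l => by
      intro x hx
      refine mem_iUnion.2 ⟨q.symm l, ?_⟩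
      rwa [q.apply_symm_apply]) }⟩

namespace BallCover

variable {𝒪 : Set (OpenPartialHomeomorph X (Euc d))} {S : Set X} (B : BallCover 𝒪 S)

theorem nonempty_of_isCompact {𝒪 : Set (OpenPartialHomeomorph X (Euc d))}
    (h𝒪 : IsOrientedAtlas 𝒪) {S : Set X} (hS : IsCompact S) : Nonempty (BallCover 𝒪 S) := by
  have h1 : ∀ x : X, ∃ e ∈ 𝒪, x ∈ e.source ∧ ∃ r, 0 < r ∧ Metric.closedBall (e x) r ⊆ e.target := by
    intro x
    obtain ⟨e, he, hx⟩ := h𝒪.cover x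
    obtain ⟨r, hr, hr'⟩ := Metric.nhds_basis_closedBall.mem_iff.1
      (e.open_target.mem_nhds (e.map_source hx))
    exact ⟨e, he, hx, r, hr, hr'⟩
  choose e he hx r hr hsub using h1
  have ho : ∀ x, IsOpen ((e x).symm '' Metric.ball (e x x) (r x)) := fun x =>
    (e x).symm.isOpen_image_of_subset_source Metric.isOpen_ball
      (Metric.ball_subset_closedBall.trans (hsub x))
  obtain ⟨t, ht⟩ := hS.elim_finite_subcover _ ho fun x _ => mem_iUnion.2
    ⟨x, e x x, Metric.mem_ball_self (hr x), (e x).left_inv (hx x)⟩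
  refine ⟨{
    num := t.card
    e := fun l => e (t.equivFin.symm l)
    center := fun l => e (t.equivFin.symm l) (t.equivFin.symm l)
    radius := fun l => r (t.equivFin.symm l)
    mem := fun l => he _
    radius_pos := fun l => hr _
    closedBall_subset := fun l => hsub _
    cover := ?_ }⟩
  intro x hx
  obtain ⟨p, hp, hxp⟩ := mem_iUnion₂.1 (ht hx)
  refine mem_iUnion.2 ⟨t.equivFin ⟨p, hp⟩, ?_⟩
  simpa using hxp

theorem isNullSet_sphere [IsManifold 𝓘(ℝ, Euc d) ∞ X] (h𝒪 : IsOrientedAtlas 𝒪) (l : Fin B.num) :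
    IsNullSet d (B.cball l \ B.oball l) := by
  refine IsNullSet.of_forall_exists_chart ?_
  rintro _ ⟨⟨y, hy, rfl⟩, -⟩
  refine ⟨B.e l, h𝒪.subset (B.mem l), (B.e l).map_target (B.closedBall_subset l hy), ?_⟩
  refine measure_mono_null ?_
    (Measure.addHaar_sphere_of_ne_zero volume (B.center l) (B.radius_pos l).ne')
  rintro z ⟨hz, ⟨w, hw, hwz⟩, hz'⟩
  have hwz' : w = z := (B.e l).symm.injOn (B.closedBall_subset l hw) hz hwz
  subst hwz'
  rw [← Metric.closedBall_sdiff_ball]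
  exact ⟨hw, fun h => hz' ⟨w, h, rfl⟩⟩

/-- The cells are dense in the union of the balls, the spheres being null. -/
theorem exists_mem_cell [T2Space X] [IsManifold 𝓘(ℝ, Euc d) ∞ X] (h𝒪 : IsOrientedAtlas 𝒪)
    {V : Set X} (hV : IsOpen V) {l : Fin B.num} (h : (V ∩ B.oball l).Nonempty) :
    ∃ l', (V ∩ B.cell l').Nonempty := by
  classical
  by_contra hne
  simp only [not_exists, not_nonempty_iff_eq_empty] at hne
  refine h.ne_empty (IsNullSet.eq_empty_of_isOpen (d := d) (IsNullSet.mono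
    (IsNullSet.iUnion (B.isNullSet_sphere h𝒪)) ?_) (hV.inter (B.isOpen_oball l)))
  rintro x ⟨hxV, hxl⟩
  by_contra hn
  simp only [mem_iUnion, mem_sdiff, not_exists, not_and, not_not] at hn
  have hne' : (Finset.univ.filter fun l => x ∈ B.oball l).Nonempty := ⟨l, by simpa using hxl⟩
  obtain ⟨m, hm, hmin⟩ := Finset.exists_min_image _ id hne'
  refine (hne m).le (⟨hxV, by simpa using hm, fun h => ?_⟩ : x ∈ V ∩ B.cell m)
  obtain ⟨l', hl', hx'⟩ := mem_iUnion₂.1 h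
  exact absurd (hmin l' (by simpa using hn l' hx')) (not_le.2 hl')

theorem volume_frontier_coordCell [T2Space X] [IsManifold 𝓘(ℝ, Euc d) ∞ X]
    (h𝒪 : IsOrientedAtlas 𝒪) {D : Set X} (hD : IsOpen D)
    (hDn : IsNullSet d (frontier D)) (l : Fin B.num) :
    volume (frontier (B.coordCell D l)) = 0 := by
  have hN : IsNullSet d (frontier (B.cell l ∩ D)) := by
    refine (((IsNullSet.iUnion (B.isNullSet_sphere h𝒪)).mono
      (B.frontier_cell_subset l)).union hDn).mono ?_
    exact (frontier_inter_subset _ _).trans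
      (union_subset_union inter_subset_left inter_subset_right)
  refine measure_mono_null ?_ (hN _ (h𝒪.subset (B.mem l)))
  intro y hy
  rw [(B.isOpen_coordCell hD l).frontier_eq] at hy
  have hyt := B.closure_coordCell_subset D l hy.1
  refine ⟨hyt, ?_⟩
  rw [mem_preimage, ((B.isOpen_cell l).inter hD).frontier_eq]
  refine ⟨?_, fun h => hy.2 ⟨hyt, h⟩⟩
  rw [← B.image_coordCell D l]
  exact mem_closure_image ((B.e l).continuousAt_symm hyt) hy.1

/-- On a Hausdorff manifold, a set `K` in which some open set `D` with null frontier is dense can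
be parametrised by pieces of `D`. -/
theorem nonempty_parametrisation (B : BallCover 𝒪 S) [T2Space X] [IsManifold 𝓘(ℝ, Euc d) ∞ X]
    (h𝒪 : IsOrientedAtlas 𝒪) {η : TopForm d X} {K D : Set X} (hD : IsOpen D)
    (hDn : IsNullSet d (frontier D)) (hDK : D ⊆ K) (hKD : K ⊆ closure D)
    (hS : ∀ x, η x ≠ 0 → x ∈ S) : Nonempty (Parametrisation 𝒪 K η) := by
  refine Parametrisation.nonempty_of_charts h𝒪 (c := B.e) (W := B.coordCell D) B.mem
    (B.isOpen_coordCell hD) (fun l => Metric.isBounded_closedBall.subset (B.coordCell_subset D l))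
    (B.closure_coordCell_subset D) (B.volume_frontier_coordCell h𝒪 hD hDn) ?_ ?_ ?_
  · intro l
    rw [B.image_coordCell]
    exact inter_subset_right.trans hDK
  · intro l l' h
    rw [B.image_coordCell, B.image_coordCell]
    exact (B.disjoint_piece h).mono (inter_subset_left.trans (B.cell_subset_piece l))
      (inter_subset_left.trans (B.cell_subset_piece l'))
  · simp_rw [B.image_coordCell]
    rw [← closure_iUnion_of_finite]
    refine closure_minimal ?_ isClosed_closure
    rintro x ⟨hxK, hx⟩
    rw [mem_closure_iff]
    intro V hV hxV
    obtain ⟨l, hl⟩ := mem_iUnion.1 (B.cover (hS x hx))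
    obtain ⟨y, hy, hyD⟩ := mem_closure_iff.1 (hKD hxK) _ (hV.inter (B.isOpen_oball l)) ⟨hxV, hl⟩
    obtain ⟨l', z, hz, hzc⟩ := B.exists_mem_cell h𝒪 (hV.inter hD) ⟨y, ⟨hy.1, hyD⟩, hy.2⟩
    exact ⟨z, hz.1, mem_iUnion.2 ⟨l', hzc, hz.2⟩⟩

/-! ### Integrals over Borel sets -/

/-- The integral of `η` over the Borel set `K`, for a form `η` that vanishes outside `S`,
computed in the pieces of the cover. -/
noncomputable def integral (η : TopForm d X) (K : Set X) : ℝ :=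
  ∑ l, ∫ y in B.coordPiece K l, TopForm.density (B.e l).symm η y

theorem integrableOn_coordPiece (h𝒪 : IsOrientedAtlas 𝒪) {η : TopForm d X}
    (hη : η.IsContinuous) (K : Set X) (l : Fin B.num) :
    IntegrableOn (TopForm.density (B.e l).symm η) (B.coordPiece K l) := by
  have h1 := hη (B.e l).symm _ (B.e l).open_target
    (contMDiffOn_symm_of_mem_maximalAtlas (h𝒪.subset (B.mem l)))
  exact ((h1.mono (B.closedBall_subset l)).integrableOn_compact
    (isCompact_closedBall _ _)).mono_set inter_subset_left

/-- On a Hausdorff manifold, the pieces of the cover are a system of representatives to which every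
parametrisation can be compared. -/
theorem value_eq_integral [T2Space X] [IsManifold 𝓘(ℝ, Euc d) ∞ X] (h𝒪 : IsOrientedAtlas 𝒪)
    {η : TopForm d X} (hη : η.IsContinuous) (hS : ∀ x, η x ≠ 0 → x ∈ S) {K : Set X}
    (hK : MeasurableSet[borel X] K) (P : Parametrisation 𝒪 K η) :
    P.value = B.integral η K := by
  refine P.value_eq_sum_integral hη (fun x y z h h' => h.eq ▸ h') B.mem
    (fun l => h𝒪.subset (B.mem l)) (fun _ => isSmoothRetraction_univ) (fun _ => subset_univ _)
    (B.measurableSet_coordPiece hK) (B.coordPiece_subset_target K)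
    (B.integrableOn_coordPiece h𝒪 hη K)
    (fun l l' y y' hy hy' h => B.eq_of_mem_coordPiece hy hy' h.eq) ?_ (fun l y hy => hy.2.2)
  intro x hxK hx
  obtain ⟨l, y, hy, hyx⟩ := B.exists_mem_coordPiece (hS x hx) hxK
  exact ⟨l, y, hy, hyx ▸ NonSep.refl _⟩

/-- The integral does not change when the set changes by a null set. -/
theorem integral_congr_null (h𝒪 : IsOrientedAtlas 𝒪) (η : TopForm d X) {K K' : Set X}
    (hK : K ⊆ K') (hN : IsNullSet d (K' \ K)) : B.integral η K = B.integral η K' := by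
  refine Finset.sum_congr rfl fun l _ => setIntegral_congr_set ?_
  refine (ae_eq_set.2 ⟨?_, ?_⟩)
  · rw [sdiff_eq_empty.2]
    · exact measure_empty
    · exact fun y hy => ⟨hy.1, hy.2.1, hK hy.2.2⟩
  · refine measure_mono_null ?_ (hN _ (h𝒪.subset (B.mem l)))
    rintro y ⟨hy, hy'⟩
    exact ⟨B.closedBall_subset l hy.1, hy.2.2, fun h => hy' ⟨hy.1, hy.2.1, h⟩⟩

/-- Inclusion-exclusion for the complement of a finite union. -/
theorem integral_compl_biUnion [T2Space X] (h𝒪 : IsOrientedAtlas 𝒪) {η : TopForm d X}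
    (hη : η.IsContinuous) {ι : Type*} (t : Finset ι) {A : ι → Set X}
    (hA : ∀ j, MeasurableSet[borel X] (A j)) :
    B.integral η (⋃ j ∈ t, A j)ᶜ =
      ∑ u ∈ t.powerset, (-1 : ℝ) ^ u.card * B.integral η (⋂ j ∈ u, A j) := by
  classical
  simp only [integral, Finset.mul_sum]
  rw [Finset.sum_comm]
  refine Finset.sum_congr rfl fun l _ => ?_
  have hU : MeasurableSet[borel X] (⋃ j ∈ t, A j) :=
    @Finset.measurableSet_biUnion _ _ (borel X) _ t fun j _ => hA j
  have h1 : B.coordPiece (⋃ j ∈ t, A j)ᶜ l =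
      B.coordPiece univ l \ ⋃ j ∈ t, B.coordPiece (A j) l := by
    ext y
    simp only [coordPiece, mem_inter_iff, mem_preimage, mem_compl_iff, mem_iUnion, mem_sdiff,
      mem_univ, and_true]
    grind
  have h2 : ⋃ j ∈ t, B.coordPiece (A j) l ⊆ B.coordPiece univ l :=
    iUnion₂_subset fun j _ y hy => ⟨hy.1, hy.2.1, mem_univ _⟩
  rw [h1, setIntegral_sdiff (Finset.measurableSet_biUnion _ fun j _ =>
    B.measurableSet_coordPiece (hA j) l) (B.integrableOn_coordPiece h𝒪 hη univ l) h2,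
    integral_biUnion_eq_sum_powerset (fun j _ => B.measurableSet_coordPiece (hA j) l)
      (fun j _ => B.integrableOn_coordPiece h𝒪 hη (A j) l)]
  have h3 : t.powerset = insert ∅ (t.powerset.filter fun u => u.Nonempty) := by
    ext u
    simp only [Finset.mem_powerset, Finset.mem_insert, Finset.mem_filter]
    rcases u.eq_empty_or_nonempty with rfl | h
    · simp
    · simp [h, h.ne_empty]
  rw [h3, Finset.sum_insert (by simp), ← h3]
  simp only [Finset.card_empty, pow_zero, one_mul, Finset.notMem_empty, iInter_of_empty,
    iInter_univ]
  rw [sub_eq_add_neg, ← Finset.sum_neg_distrib]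
  congr 1
  refine Finset.sum_congr rfl fun u hu => ?_
  have h4 : ⋂ j ∈ u, B.coordPiece (A j) l = B.coordPiece (⋂ j ∈ u, A j) l := by
    obtain ⟨j₀, hj₀⟩ := (Finset.mem_filter.1 hu).2
    ext y
    simp only [coordPiece, mem_inter_iff, mem_preimage, mem_iInter]
    constructor
    · exact fun h => ⟨(h j₀ hj₀).1, (h j₀ hj₀).2.1, fun j hj => (h j hj).2.2⟩
    · exact fun h j hj => ⟨h.1, h.2.1, h.2.2 j hj⟩
  rw [h4, pow_succ, smul_eq_mul]
  ring

end BallCover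

end BallCover

/-! ### The colimit of an adjunction system -/

theorem mem_maximalAtlas_of_contMDiffOn {d : ℕ} {X : Type*} [TopologicalSpace X]
    [ChartedSpace (Euc d) X] [IsManifold 𝓘(ℝ, Euc d) ∞ X] {e : OpenPartialHomeomorph X (Euc d)}
    (h : ContMDiffOn 𝓘(ℝ, Euc d) 𝓘(ℝ, Euc d) ∞ e e.source)
    (h' : ContMDiffOn 𝓘(ℝ, Euc d) 𝓘(ℝ, Euc d) ∞ e.symm e.target) :
    e ∈ IsManifold.maximalAtlas 𝓘(ℝ, Euc d) ∞ X := by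
  rw [IsManifold.mem_maximalAtlas_iff]
  intro c hc
  have hc' := IsManifold.subset_maximalAtlas (I := 𝓘(ℝ, Euc d)) (n := ∞) hc
  have h1 : ContDiffOn ℝ ∞ (c ∘ e.symm) (e.target ∩ e.symm ⁻¹' c.source) := by
    rw [← contMDiffOn_iff_contDiffOn]
    exact (contMDiffOn_of_mem_maximalAtlas hc').comp (h'.mono inter_subset_left) fun y hy => hy.2
  have h2 : ContDiffOn ℝ ∞ (e ∘ c.symm) (c.target ∩ c.symm ⁻¹' e.source) := by
    rw [← contMDiffOn_iff_contDiffOn]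
    exact h.comp ((contMDiffOn_symm_of_mem_maximalAtlas hc').mono inter_subset_left)
      fun y hy => hy.2
  rw [contDiffGroupoid, mem_groupoid_of_pregroupoid, mem_groupoid_of_pregroupoid]
  simp only [contDiffPregroupoid, modelWithCornersSelf_coe, modelWithCornersSelf_coe_symm]
  simpa using ⟨⟨h1, h2⟩, h2, h1⟩

namespace AdjunctionSystem

variable {d n : ℕ} {M : Fin n → Type*} [∀ i, TopologicalSpace (M i)]
    [∀ i, ChartedSpace (Euc d) (M i)] (G : AdjunctionSystem d n M)

theorem exists_φ_eq (q : G.Colimit) : ∃ i x, G.φ i x = q := by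
  obtain ⟨⟨i, x⟩, h⟩ := Quotient.exists_rep q
  exact ⟨i, x, h⟩

theorem injective_φ (i : Fin n) : Function.Injective (G.φ i) := (G.isOpenEmbedding_φ i).injective

theorem φ_f {i j : Fin n} {x : M i} (hx : x ∈ G.U i j) : G.φ j (G.f i j x) = G.φ i x :=
  (G.φ_eq_iff.2 ⟨hx, rfl⟩).symm

theorem preimage_range_φ (i j : Fin n) : G.φ i ⁻¹' range (G.φ j) = G.U i j := by
  ext x
  constructor
  · rintro ⟨y, hy⟩
    exact (G.φ_eq_iff.1 hy.symm).1
  · exact fun hx => ⟨_, G.φ_f hx⟩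

theorem preimage_closure_range_φ (i j : Fin n) :
    G.φ i ⁻¹' closure (range (G.φ j)) = closure (G.U i j) := by
  rw [(G.isOpenEmbedding_φ i).isOpenMap.preimage_closure_eq_closure_preimage
    (G.isOpenEmbedding_φ i).continuous, preimage_range_φ]

/-- The inverse of the open embedding `φ i`, with arbitrary values outside its range. -/
noncomputable def ψ (i : Fin n) [Nonempty (M i)] : G.Colimit → M i := Function.invFun (G.φ i)

theorem ψ_φ (i : Fin n) [Nonempty (M i)] (x : M i) : G.ψ i (G.φ i x) = x :=
  Function.leftInverse_invFun (G.injective_φ i) x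

section Smooth

variable [∀ i, IsManifold 𝓘(ℝ, Euc d) ∞ (M i)]

theorem liftChart_mem_maximalAtlas_of_mem_atlas {i : Fin n}
    {e : OpenPartialHomeomorph (M i) (Euc d)} (he : e ∈ atlas (Euc d) (M i)) :
    G.liftChart i e ∈ IsManifold.maximalAtlas 𝓘(ℝ, Euc d) ∞ G.Colimit :=
  IsManifold.subset_maximalAtlas ⟨i, e, he, rfl⟩

theorem contMDiff_φ (i : Fin n) : ContMDiff 𝓘(ℝ, Euc d) 𝓘(ℝ, Euc d) ∞ (G.φ i) := by
  intro x
  set e := chartAt (Euc d) x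
  have h1 : ContMDiffAt 𝓘(ℝ, Euc d) 𝓘(ℝ, Euc d) ∞ e x :=
    contMDiffAt_of_mem_maximalAtlas (IsManifold.chart_mem_maximalAtlas x) (mem_chart_source _ x)
  have h2 : ContMDiffAt 𝓘(ℝ, Euc d) 𝓘(ℝ, Euc d) ∞ (G.liftChart i e).symm (e x) := by
    refine contMDiffAt_symm_of_mem_maximalAtlas
      (G.liftChart_mem_maximalAtlas_of_mem_atlas (chart_mem_atlas _ x)) ?_
    have : e x ∈ e.target := mem_chart_target _ x
    simpa [liftChart] using this
  refine (h2.comp x h1).congr_of_eventuallyEq ?_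
  filter_upwards [e.open_source.mem_nhds (mem_chart_source _ x)] with z hz
  simp [liftChart_symm_apply, e.left_inv hz]

theorem contMDiffOn_ψ (i : Fin n) [Nonempty (M i)] :
    ContMDiffOn 𝓘(ℝ, Euc d) 𝓘(ℝ, Euc d) ∞ (G.ψ i) (range (G.φ i)) := by
  rintro _ ⟨x, rfl⟩
  apply ContMDiffAt.contMDiffWithinAt
  set e := chartAt (Euc d) x
  have hs : (G.liftChart i e).source = G.φ i '' e.source := rfl
  have hx : G.φ i x ∈ (G.liftChart i e).source := mem_image_of_mem _ (mem_chart_source _ x)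
  have h1 : ContMDiffAt 𝓘(ℝ, Euc d) 𝓘(ℝ, Euc d) ∞ (G.liftChart i e) (G.φ i x) :=
    contMDiffAt_of_mem_maximalAtlas
      (G.liftChart_mem_maximalAtlas_of_mem_atlas (chart_mem_atlas _ x)) hx
  have h2 : ContMDiffAt 𝓘(ℝ, Euc d) 𝓘(ℝ, Euc d) ∞ e.symm (G.liftChart i e (G.φ i x)) := by
    rw [liftChart_apply]
    exact contMDiffAt_symm_of_mem_maximalAtlas (IsManifold.chart_mem_maximalAtlas x)
      (mem_chart_target _ x)
  refine (h2.comp _ h1).congr_of_eventuallyEq ?_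
  filter_upwards [(G.liftChart i e).open_source.mem_nhds hx] with z hz
  rw [hs] at hz
  obtain ⟨w, hw, rfl⟩ := hz
  simp [liftChart_apply, ψ_φ, e.left_inv hw]

theorem liftChart_mem_maximalAtlas {i : Fin n} {e : OpenPartialHomeomorph (M i) (Euc d)}
    (he : e ∈ IsManifold.maximalAtlas 𝓘(ℝ, Euc d) ∞ (M i)) :
    G.liftChart i e ∈ IsManifold.maximalAtlas 𝓘(ℝ, Euc d) ∞ G.Colimit := by
  have hsrc : (G.liftChart i e).source = G.φ i '' e.source := rfl
  have htgt : (G.liftChart i e).target = e.target := rfl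
  have h1 : ContMDiffOn 𝓘(ℝ, Euc d) 𝓘(ℝ, Euc d) ∞ (G.liftChart i e) (G.liftChart i e).source := by
    rintro _ ⟨x, hx, rfl⟩
    have : Nonempty (M i) := ⟨x⟩
    refine ((contMDiffOn_of_mem_maximalAtlas he).comp ((G.contMDiffOn_ψ i).mono
      (image_subset_range _ e.source)) ?_ |>.congr ?_) _ (mem_image_of_mem _ hx)
    · rintro _ ⟨y, hy, rfl⟩
      rwa [mem_preimage, ψ_φ]
    · rintro _ ⟨y, hy, rfl⟩
      simp [liftChart_apply, ψ_φ]
  have h2 : ContMDiffOn 𝓘(ℝ, Euc d) 𝓘(ℝ, Euc d) ∞ (G.liftChart i e).symm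
      (G.liftChart i e).target := by
    refine ((G.contMDiff_φ i).comp_contMDiffOn (contMDiffOn_symm_of_mem_maximalAtlas he)).congr ?_
    intro y _
    simp [liftChart_symm_apply]
  exact mem_maximalAtlas_of_contMDiffOn h1 h2


variable {𝒪 : ∀ i, Set (OpenPartialHomeomorph (M i) (Euc d))}

/-- The induced orientation of the colimit is an orientation. -/
theorem isOrientedAtlas_orientation (h𝒪 : ∀ i, IsOrientedAtlas (𝒪 i))
    (hf : ∀ i j, PreservesOrientationOn (𝒪 i) (𝒪 j) (G.f i j) (G.U i j)) :
    IsOrientedAtlas (G.orientation 𝒪) where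
  subset := by
    rintro _ ⟨i, e, he, rfl⟩
    exact G.liftChart_mem_maximalAtlas ((h𝒪 i).subset he)
  cover := by
    intro q
    obtain ⟨i, x, rfl⟩ := G.exists_φ_eq q
    obtain ⟨e, he, hx⟩ := (h𝒪 i).cover x
    exact ⟨_, ⟨i, e, he, rfl⟩, mem_image_of_mem _ hx⟩
  compat := by
    rintro q - _ ⟨i, e, he, rfl⟩ ⟨x, hx, rfl⟩ _ ⟨j, e', he', rfl⟩ ⟨y, hy, hyx⟩
    obtain ⟨hU, hfx⟩ := G.φ_eq_iff.1 hyx.symm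
    have h1 := hf i j x hU e he hx e' he' (by rwa [hfx])
    rw [liftChart_apply]
    convert h1 using 2
    apply Filter.EventuallyEq.fderiv_eq
    have h2 : ∀ᶠ z in 𝓝 (e x), e.symm z ∈ G.U i j := by
      have := (e.continuousAt_symm (e.map_source hx))
      rw [ContinuousAt, e.left_inv hx] at this
      exact this ((G.isOpen_U i j).mem_nhds hU)
    filter_upwards [h2] with z hz
    rw [liftChart_symm_apply, id, ← G.φ_f hz, liftChart_apply]

/-- Extensions `F i j` of the gluing maps to the closures of the gluing regions, satisfying the
conditions of an adjunction system. -/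
structure IsClosureGluing (F : ∀ i j, M i → M j) : Prop where
  eqOn : ∀ i j, EqOn (F i j) (G.f i j) (G.U i j)
  smooth : ∀ i j, SmoothOnSet d (F i j) (closure (G.U i j))
  mapsTo : ∀ i j, MapsTo (F i j) (closure (G.U i j)) (closure (G.U j i))
  left_inv : ∀ i j, ∀ x ∈ closure (G.U i j), F j i (F i j x) = x
  cocycle : ∀ i j k x, x ∈ closure (G.U i j) → x ∈ closure (G.U i k) →
      F i j x ∈ closure (G.U j k) ∧ F j k (F i j x) = F i k x

end Smooth

variable {G} {F : ∀ i j, M i → M j}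

namespace IsClosureGluing

/-- Points of the colimit are non-separated exactly when they correspond under the extended
gluing maps. -/
theorem nonSep_φ_iff [∀ i, T2Space (M i)] (hF : G.IsClosureGluing F) {i j : Fin n} {x : M i}
    {y : M j} : NonSep (G.φ i x) (G.φ j y) ↔ x ∈ closure (G.U i j) ∧ F i j x = y := by
  constructor
  · intro h
    have hx : x ∈ closure (G.U i j) := by
      rw [← G.preimage_closure_range_φ]
      exact h.mem_closure (G.isOpenEmbedding_φ j).isOpen_range (mem_range_self y)
    refine ⟨hx, ?_⟩
    by_contra hne
    obtain ⟨V, W, hV, hW, hxV, hyW, hVW⟩ := t2_separation hne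
    obtain ⟨N, hN, hxN, hNV⟩ := mem_nhdsWithin.1
      ((hF.smooth i j).continuousOn x hx (hV.mem_nhds hxV))
    obtain ⟨_, ⟨a, ha, rfl⟩, ⟨b, hb, hab⟩⟩ := h.nonempty_inter
      ((G.isOpenEmbedding_φ i).isOpenMap N hN) (mem_image_of_mem _ hxN)
      ((G.isOpenEmbedding_φ j).isOpenMap W hW) (mem_image_of_mem _ hyW)
    obtain ⟨haU, hfa⟩ := G.φ_eq_iff.1 hab.symm
    have h1 : F i j a ∈ V := hNV ⟨ha, subset_closure haU⟩
    rw [hF.eqOn i j haU, hfa] at h1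
    exact hVW.le_bot ⟨h1, hb⟩
  · rintro ⟨hx, rfl⟩
    unfold NonSep
    rw [Filter.inf_neBot_iff]
    intro V hV W hW
    have hV' := (G.isOpenEmbedding_φ i).continuous.continuousAt hV
    have hW' := (hF.smooth i j).continuousOn x hx
      ((G.isOpenEmbedding_φ j).continuous.continuousAt hW)
    obtain ⟨N, hN, hxN, hNV⟩ := mem_nhdsWithin.1 hW'
    obtain ⟨a, ha, haU⟩ := mem_closure_iff_nhds.1 hx _ (Filter.inter_mem hV' (hN.mem_nhds hxN))
    refine ⟨G.φ i a, ha.1, ?_⟩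
    have h1 := hNV ⟨ha.2, subset_closure haU⟩
    rw [mem_preimage, mem_preimage, hF.eqOn i j haU, G.φ_f haU] at h1
    exact h1

theorem nonSep_trans [∀ i, T2Space (M i)] (hF : G.IsClosureGluing F) (p q r : G.Colimit)
    (h : NonSep p q) (h' : NonSep q r) : NonSep p r := by
  obtain ⟨i, x, rfl⟩ := G.exists_φ_eq p
  obtain ⟨j, y, rfl⟩ := G.exists_φ_eq q
  obtain ⟨k, z, rfl⟩ := G.exists_φ_eq r
  obtain ⟨h1, rfl⟩ := hF.nonSep_φ_iff.1 h.symm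
  obtain ⟨h2, rfl⟩ := hF.nonSep_φ_iff.1 h'
  exact hF.nonSep_φ_iff.2 (hF.cocycle j i k y h1 h2)

theorem apply_self (hF : G.IsClosureGluing F) (i : Fin n) (x : M i) : F i i x = x := by
  rw [hF.eqOn i i (by rw [G.U_self]; trivial), G.f_self]

/-- The map that moves a point in the closure of the range of `φ k` to the point of the range
from which it is not separated. -/
noncomputable def retraction (F : ∀ i j, M i → M j) (k : Fin n) (q : G.Colimit) : G.Colimit :=
  G.φ k (F (Quotient.out q).1 k (Quotient.out q).2)

theorem retraction_φ (hF : G.IsClosureGluing F) {i k : Fin n} {x : M i}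
    (hx : x ∈ closure (G.U i k)) : retraction F k (G.φ i x) = G.φ k (F i k x) := by
  have h1 : G.φ (Quotient.out (G.φ i x)).1 (Quotient.out (G.φ i x)).2 = G.φ i x :=
    Quotient.out_eq _
  obtain ⟨h2, h3⟩ := G.φ_eq_iff.1 h1.symm
  obtain ⟨-, h4⟩ := hF.cocycle _ _ k x (subset_closure h2) hx
  rw [hF.eqOn _ _ h2, h3] at h4
  rw [retraction, h4]

theorem isSmoothRetraction [∀ i, IsManifold 𝓘(ℝ, Euc d) ∞ (M i)] [∀ i, T2Space (M i)]
    (hF : G.IsClosureGluing F) (k : Fin n) :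
    IsSmoothRetraction d (range (G.φ k)) (retraction F k) := by
  have hex : ∀ q ∈ closure (range (G.φ k)), ∃ i, ∃ x ∈ closure (G.U i k), G.φ i x = q := by
    intro q hq
    obtain ⟨i, x, rfl⟩ := G.exists_φ_eq q
    exact ⟨i, x, by rwa [← G.preimage_closure_range_φ], rfl⟩
  refine ⟨(G.isOpenEmbedding_φ k).isOpen_range, ?_, fun q hq => mem_range_self _, ?_, ?_⟩
  · intro q hq
    obtain ⟨i, x, hx, rfl⟩ := hex q hq
    obtain ⟨V, h, hV, hxV, hh, he⟩ := hF.smooth i k x hx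
    have : Nonempty (M i) := ⟨x⟩
    refine ⟨G.φ i '' V, G.φ k ∘ h ∘ G.ψ i, (G.isOpenEmbedding_φ i).isOpenMap V hV,
      mem_image_of_mem _ hxV, ?_, ?_⟩
    · refine (G.contMDiff_φ k).comp_contMDiffOn
        (hh.comp ((G.contMDiffOn_ψ i).mono (image_subset_range _ V)) ?_)
      rintro _ ⟨y, hy, rfl⟩
      rwa [mem_preimage, ψ_φ]
    · rintro _ ⟨hqc, y, hy, rfl⟩
      have hyc : y ∈ closure (G.U i k) := by rwa [← G.preimage_closure_range_φ]
      rw [hF.retraction_φ hyc]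
      simp [ψ_φ, he ⟨hyc, hy⟩]
  · intro q hq
    obtain ⟨i, x, hx, rfl⟩ := hex q hq
    rw [hF.retraction_φ hx]
    exact hF.nonSep_φ_iff.2 ⟨hx, rfl⟩
  · rintro q hq _ ⟨w, rfl⟩ h
    obtain ⟨i, x, hx, rfl⟩ := hex q hq
    rw [hF.retraction_φ hx, (hF.nonSep_φ_iff.1 h).2]

/-- The trace on `M k` of a closed compact subset of the colimit is compact: a limit point outside
`M k` can be moved into `M k` by the retraction. -/
theorem isCompact_preimage_φ [∀ i, IsManifold 𝓘(ℝ, Euc d) ∞ (M i)] [∀ i, T2Space (M i)]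
    (hF : G.IsClosureGluing F) {S : Set G.Colimit} (hS : IsCompact S) (hSc : IsClosed S)
    (k : Fin n) : IsCompact (G.φ k ⁻¹' S) := by
  have hρ := hF.isSmoothRetraction k
  rw [isCompact_iff_ultrafilter_le_nhds]
  intro f hf
  have h1 : ((f.map (G.φ k) : Ultrafilter G.Colimit) : Filter G.Colimit) ≤ Filter.principal S := by
    rw [Filter.le_principal_iff] at hf ⊢
    exact hf
  obtain ⟨s, hs, hfs⟩ := hS.ultrafilter_le_nhds _ h1
  have h2 : ((f.map (G.φ k) : Ultrafilter G.Colimit) : Filter G.Colimit) ≤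
      Filter.principal (range (G.φ k)) := by
    rw [Filter.le_principal_iff]
    exact Filter.mem_map.2 (Filter.univ_mem' fun x => mem_range_self x)
  have h2' := h2.trans (Filter.principal_mono.2 subset_closure)
  have hsc : s ∈ closure (range (G.φ k)) :=
    mem_closure_iff_ultrafilter.2 ⟨f.map (G.φ k), Filter.le_principal_iff.1 h2, hfs⟩
  obtain ⟨w, hw⟩ := hρ.mem s hsc
  have h3 : Filter.Tendsto (retraction F k) (Filter.map (G.φ k) f) (𝓝 (G.φ k w)) := by
    rw [hw]
    exact (hρ.smooth.continuousOn s hsc).mono_left (le_inf hfs h2')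
  have h4 : Filter.Tendsto (G.φ k) f (𝓝 (G.φ k w)) := by
    refine (Filter.tendsto_map'_iff.1 h3).congr fun x => ?_
    exact hρ.apply_of_mem (mem_range_self x)
  have h5 : (f : Filter (M k)) ≤ 𝓝 w := by
    exact ((G.isOpenEmbedding_φ k).isInducing.tendsto_nhds_iff (f := id)).2 h4
  refine ⟨w, ?_, h5⟩
  exact (hSc.preimage (G.isOpenEmbedding_φ k).continuous).mem_of_tendsto (f := id) h5
    (Filter.le_principal_iff.1 hf)

end IsClosureGluing

end AdjunctionSystem

/-! ### Integration over the colimit -/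

namespace AdjunctionSystem

variable {d n : ℕ} {M : Fin n → Type*} [∀ i, TopologicalSpace (M i)]
    [∀ i, ChartedSpace (Euc d) (M i)] {G : AdjunctionSystem d n M} {F : ∀ i j, M i → M j}

/-- The points of `M k` that are glued to, or not separated from, no point of an `M j` of higher
rank. As `k` varies, these open sets contain exactly one representative of each class of
non-separated points of the colimit. -/
def region (G : AdjunctionSystem d n M) (σ : Fin n → ℕ) (k : Fin n) : Set (M k) :=
  (⋃ j ∈ Finset.univ.filter (fun j => σ k < σ j), closure (G.U k j))ᶜ

theorem isClosed_biUnion_closure_U (t : Finset (Fin n)) (k : Fin n) :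
    IsClosed (⋃ j ∈ t, closure (G.U k j)) :=
  t.finite_toSet.isClosed_biUnion fun _ _ => isClosed_closure

theorem isOpen_region (σ : Fin n → ℕ) (k : Fin n) : IsOpen (G.region σ k) :=
  (isClosed_biUnion_closure_U _ k).isOpen_compl

theorem mem_region_iff {σ : Fin n → ℕ} {k : Fin n} {x : M k} :
    x ∈ G.region σ k ↔ ∀ j, σ k < σ j → x ∉ closure (G.U k j) := by
  simp [region]

theorem closureIn_eq (s : Finset (Fin n)) (i : Fin n) :
    G.closureIn s i = closure (⋂ j ∈ s, G.U i j) := by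
  simp only [closureIn, inter, preimage_iInter, preimage_range_φ]

variable [∀ i, IsManifold 𝓘(ℝ, Euc d) ∞ (M i)]

theorem isNullSet_frontier_region (hG : ∀ i j, IsRegularDomain d (closure (G.U i j)))
    (σ : Fin n → ℕ) (k : Fin n) : IsNullSet d (frontier (G.region σ k)) := by
  refine (IsNullSet.iUnion fun j => (hG k j).isNullSet_frontier).mono ?_
  rw [region, frontier_compl, (isClosed_biUnion_closure_U _ k).frontier_eq]
  rintro x ⟨hx, hx'⟩
  obtain ⟨j, hj, hxj⟩ := mem_iUnion₂.1 hx
  refine mem_iUnion.2 ⟨j, ?_⟩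
  rw [isClosed_closure.frontier_eq]
  exact ⟨hxj, fun h => hx' (interior_mono (subset_iUnion₂_of_subset j hj subset_rfl) h)⟩

/-- The closure of the intersection of the gluing regions fills the intersection of their closures,
up to a null set: the `U i j` are dense in the interiors of their closures. -/
theorem isNullSet_biInter_closure_diff (hG : ∀ i j, IsRegularDomain d (closure (G.U i j)))
    (s : Finset (Fin n)) (i : Fin n) :
    IsNullSet d ((⋂ j ∈ s, closure (G.U i j)) \ interior (G.closureIn s i)) := by
  refine (IsNullSet.iUnion fun j => (hG i j).isNullSet_frontier).mono ?_
  rintro x ⟨hx, hx'⟩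
  rw [mem_iInter₂] at hx
  by_contra hn
  simp only [mem_iUnion, not_exists, isClosed_closure.frontier_eq, mem_sdiff, not_and,
    not_not] at hn
  have hopen : IsOpen (⋂ j ∈ s, interior (closure (G.U i j))) :=
    s.finite_toSet.isOpen_biInter fun _ _ => isOpen_interior
  refine hx' (mem_interior.2 ⟨_, ?_, hopen, mem_iInter₂.2 fun j hj => hn j (hx j hj)⟩)
  -- finitely many sets that are dense in a common open set have dense intersection there
  have key : ∀ t : Finset (Fin n), ∀ V : Set (M i), IsOpen V → V.Nonempty →
      (∀ j ∈ t, V ⊆ closure (G.U i j)) → (V ∩ ⋂ j ∈ t, G.U i j).Nonempty := by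
    classical
    intro t
    induction t using Finset.induction_on with
    | empty => intro V _ hV _; simpa using hV
    | insert j t _ ih =>
      intro V hV ⟨y, hy⟩ hVt
      obtain ⟨z, hz, hz'⟩ := ih (V ∩ G.U i j) (hV.inter (G.isOpen_U i j))
        (mem_closure_iff.1 (hVt j (Finset.mem_insert_self j t) hy) V hV hy)
        fun j' hj' => inter_subset_left.trans (hVt j' (Finset.mem_insert_of_mem hj'))
      refine ⟨z, hz.1, ?_⟩
      rw [Finset.set_biInter_insert]
      exact ⟨hz.2, hz'⟩
  intro y hy
  rw [closureIn, mem_closure_iff]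
  intro V hV hyV
  obtain ⟨z, hz, hz'⟩ := key s (V ∩ ⋂ j ∈ s, interior (closure (G.U i j))) (hV.inter hopen)
    ⟨y, hyV, hy⟩ fun j hj w hw => interior_subset (mem_iInter₂.1 hw.2 j hj)
  refine ⟨z, hz.1, ?_⟩
  rw [mem_preimage, inter, mem_iInter₂]
  intro j hj
  have := mem_iInter₂.1 hz' j hj
  rwa [← G.preimage_range_φ] at this

theorem density_liftChart_symm {k : Fin n} {e : OpenPartialHomeomorph (M k) (Euc d)}
    {η : TopForm d G.Colimit}
    (he : e ∈ IsManifold.maximalAtlas 𝓘(ℝ, Euc d) ∞ (M k)) {y : Euc d} (hy : y ∈ e.target) :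
    TopForm.density (G.liftChart k e).symm η y =
      TopForm.density e.symm (TopForm.pullback (G.φ k) η) y := by
  rw [TopForm.density_pullback ((G.contMDiff_φ k).mdifferentiableAt (by simp))
    ((contMDiffAt_symm_of_mem_maximalAtlas he hy).mdifferentiableAt (by simp))]
  exact TopForm.density_congr (Filter.Eventually.of_forall fun z => G.liftChart_symm_apply k e z)

variable [∀ i, T2Space (M i)] {𝒪 : ∀ i, Set (OpenPartialHomeomorph (M i) (Euc d))}
  {η : TopForm d G.Colimit} (B : ∀ k, BallCover (𝒪 k) (G.φ k ⁻¹' η.supportOn univ))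
  {σ : Fin n → ℕ}

/-- The integral over the colimit is the sum of the integrals over the regions of highest rank. -/
theorem IsClosureGluing.value_eq_sum_integral (hF : G.IsClosureGluing F)
    (h𝒪 : ∀ i, IsOrientedAtlas (𝒪 i)) (hη : η.IsContinuous) (hσ : Function.Injective σ)
    (P : Parametrisation (G.orientation 𝒪) univ η) :
    P.value = ∑ k, (B k).integral (TopForm.pullback (G.φ k) η) (G.region σ k) := by
  have hmax : ∀ k l, (B k).e l ∈ IsManifold.maximalAtlas 𝓘(ℝ, Euc d) ∞ (M k) :=
    fun k l => (h𝒪 k).subset ((B k).mem l)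
  have hηk : ∀ k, (TopForm.pullback (G.φ k) η).IsContinuous := fun k =>
    hη.pullback (G.contMDiff_φ k)
  have hdens : ∀ k l, EqOn (TopForm.density ((B k).e l).symm (TopForm.pullback (G.φ k) η))
      (TopForm.density (G.liftChart k ((B k).e l)).symm η) ((B k).coordPiece (G.region σ k) l) :=
    fun k l y hy => (density_liftChart_symm (hmax k l)
      ((B k).coordPiece_subset_target _ l hy)).symm
  have hmeas : ∀ k l, MeasurableSet ((B k).coordPiece (G.region σ k) l) := fun k l => by
    refine (B k).measurableSet_coordPiece ?_ l
    exact MeasurableSpace.measurableSet_generateFrom (isOpen_region σ k)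
  rw [P.value_eq_sum_integral hη hF.nonSep_trans
    (ι := Σ k, Fin (B k).num) (c := fun p => G.liftChart p.1 ((B p.1).e p.2))
    (fun p => ⟨p.1, _, (B p.1).mem p.2, rfl⟩)
    (fun p => G.liftChart_mem_maximalAtlas (hmax _ _))
    (fun p => hF.isSmoothRetraction p.1) (fun p => image_subset_range _ _)
    (E := fun p => (B p.1).coordPiece (G.region σ p.1) p.2)
    (fun p => hmeas p.1 p.2)
    (fun p => (B p.1).coordPiece_subset_target _ p.2)
    (fun p => ((integrableOn_congr_fun (hdens _ _) (hmeas _ _)).1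
      ((B p.1).integrableOn_coordPiece (h𝒪 p.1) (hηk p.1) _ p.2)))
    ?_ ?_ fun _ _ _ => mem_univ _]
  · rw [Fintype.sum_sigma]
    exact Finset.sum_congr rfl fun k _ => Finset.sum_congr rfl fun l _ =>
      setIntegral_congr_fun (hmeas k l) (hdens k l).symm
  · rintro ⟨k, l⟩ ⟨k', l'⟩ y y' hy hy' h
    simp only [liftChart_symm_apply] at h hy hy'
    obtain ⟨h1, h2⟩ := hF.nonSep_φ_iff.1 h
    have h1' := (hF.nonSep_φ_iff.1 h.symm).1
    have hk : k = k' := by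
      apply hσ
      rcases lt_trichotomy (σ k) (σ k') with hlt | heq | hgt
      · exact absurd h1 (mem_region_iff.1 hy.2.2 k' hlt)
      · exact heq
      · exact absurd h1' (mem_region_iff.1 hy'.2.2 k hgt)
    subst hk
    rw [hF.apply_self] at h2
    obtain ⟨rfl, rfl⟩ := (B k).eq_of_mem_coordPiece hy hy' h2
    exact ⟨rfl, rfl⟩
  · classical
    intro q _ hq
    obtain ⟨i, x, rfl⟩ := G.exists_φ_eq q
    -- the index of highest rank among those `k` for which `M k` meets the class of the point
    obtain ⟨k, hk, hmax⟩ := Finset.exists_max_image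
      (Finset.univ.filter fun k => x ∈ closure (G.U i k)) σ
      ⟨i, by simpa using subset_closure (G.U_self i ▸ mem_univ x)⟩
    have hxk : x ∈ closure (G.U i k) := by simpa using hk
    have hns : NonSep (G.φ i x) (G.φ k (F i k x)) := hF.nonSep_φ_iff.2 ⟨hxk, rfl⟩
    have hS : F i k x ∈ G.φ k ⁻¹' η.supportOn univ := by
      have h1 := hns.symm.mem_closure hη.isOpen_ne_zero hq
      simpa [TopForm.supportOn] using h1
    have hreg : F i k x ∈ G.region σ k := by
      refine mem_region_iff.2 fun j hj hc => ?_
      have h1 := hF.nonSep_trans _ _ _ hns (hF.nonSep_φ_iff.2 ⟨hc, rfl⟩)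
      have h2 := hmax j (by simpa using (hF.nonSep_φ_iff.1 h1).1)
      omega
    obtain ⟨l, y, hy, hyx⟩ := (B k).exists_mem_coordPiece hS hreg
    refine ⟨⟨k, l⟩, y, hy, ?_⟩
    simp only [liftChart_symm_apply, hyx]
    exact hns

/-- The cells of the covers of the `M k`, cut down to the regions of highest rank, parametrise the
colimit. -/
theorem nonempty_parametrisation
    (B : ∀ k, BallCover (𝒪 k) (G.φ k ⁻¹' η.supportOn univ))
    (hG : ∀ i j, IsRegularDomain d (closure (G.U i j)))
    (h𝒪 : ∀ i, IsOrientedAtlas (𝒪 i))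
    (hf : ∀ i j, PreservesOrientationOn (𝒪 i) (𝒪 j) (G.f i j) (G.U i j))
    (hη : η.IsContinuous) (hσ : Function.Injective σ) :
    Nonempty (Parametrisation (G.orientation 𝒪) univ η) := by
  have himage : ∀ p : (Σ k, Fin (B k).num), (G.liftChart p.1 ((B p.1).e p.2)).symm ''
      (B p.1).coordCell (G.region σ p.1) p.2 =
      G.φ p.1 '' ((B p.1).cell p.2 ∩ G.region σ p.1) := by
    intro p
    rw [← (B p.1).image_coordCell, image_image]
    exact image_congr fun y _ => G.liftChart_symm_apply _ _ y
  refine Parametrisation.nonempty_of_charts (G.isOrientedAtlas_orientation h𝒪 hf)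
    (ι := Σ k, Fin (B k).num) (c := fun p => G.liftChart p.1 ((B p.1).e p.2))
    (W := fun p => (B p.1).coordCell (G.region σ p.1) p.2)
    (fun p => ⟨p.1, _, (B p.1).mem p.2, rfl⟩)
    (fun p => (B p.1).isOpen_coordCell (isOpen_region σ p.1) p.2)
    (fun p => Metric.isBounded_closedBall.subset ((B p.1).coordCell_subset _ p.2))
    (fun p => (B p.1).closure_coordCell_subset _ p.2)
    (fun p => (B p.1).volume_frontier_coordCell (h𝒪 p.1) (isOpen_region σ p.1)
      (isNullSet_frontier_region hG σ p.1) p.2) (fun _ => subset_univ _) ?_ ?_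
  · intro p p' hp
    rw [himage, himage, Set.disjoint_left]
    rintro _ ⟨x, ⟨hx, hxr⟩, rfl⟩ ⟨x', ⟨hx', hxr'⟩, h⟩
    obtain ⟨k, l⟩ := p
    obtain ⟨k', l'⟩ := p'
    obtain ⟨h1, h2⟩ := G.φ_eq_iff.1 h.symm
    have h1' := (G.φ_eq_iff.1 h).1
    have hk : k = k' := by
      apply hσ
      rcases lt_trichotomy (σ k) (σ k') with hlt | heq | hgt
      · exact absurd (subset_closure h1) (mem_region_iff.1 hxr k' hlt)
      · exact heq
      · exact absurd (subset_closure h1') (mem_region_iff.1 hxr' k hgt)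
    subst hk
    have hxx : x' = x := G.injective_φ k h
    subst hxx
    have hl : l ≠ l' := fun h => hp (by rw [h])
    exact ((B k).disjoint_piece hl).le_bot
      ⟨(B k).cell_subset_piece l hx, (B k).cell_subset_piece l' hx'⟩
  · classical
    simp_rw [himage]
    rw [← closure_iUnion_of_finite]
    refine closure_minimal ?_ isClosed_closure
    rintro q ⟨-, hq⟩
    rw [mem_closure_iff]
    intro N hN hqN
    -- on a small enough open set, the index of highest rank is the only one to consider
    have hN' : IsOpen (N ∩ {q | η q ≠ 0}) := hN.inter hη.isOpen_ne_zero
    obtain ⟨i, x, rfl⟩ := G.exists_φ_eq q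
    obtain ⟨k, hk, hmax⟩ := Finset.exists_max_image
      (Finset.univ.filter fun k => ((N ∩ {q | η q ≠ 0}) ∩ range (G.φ k)).Nonempty) σ
      ⟨i, by simpa using ⟨G.φ i x, ⟨hqN, hq⟩, mem_range_self x⟩⟩
    obtain ⟨_, hz, z, rfl⟩ : ((N ∩ {q | η q ≠ 0}) ∩ range (G.φ k)).Nonempty := by simpa using hk
    set V := G.φ k ⁻¹' (N ∩ {q | η q ≠ 0}) with hV
    have hVo : IsOpen V := hN'.preimage (G.isOpenEmbedding_φ k).continuous
    have hVr : V ⊆ G.region σ k := by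
      intro w hw
      refine mem_region_iff.2 fun j hj hc => ?_
      obtain ⟨v, hv, hvU⟩ := mem_closure_iff.1 hc V hVo hw
      rw [← G.preimage_range_φ] at hvU
      have := hmax j (by simpa using ⟨G.φ k v, hv, hvU⟩)
      omega
    have hzS : z ∈ G.φ k ⁻¹' η.supportOn univ := subset_closure ⟨mem_univ _, hz.2⟩
    obtain ⟨l, hl⟩ := mem_iUnion.1 ((B k).cover hzS)
    obtain ⟨l', w, hw, hwl⟩ := (B k).exists_mem_cell (h𝒪 k) hVo ⟨z, hz, hl⟩
    exact ⟨G.φ k w, hw.1, mem_iUnion.2 ⟨⟨k, l'⟩, mem_image_of_mem _ ⟨hwl, hVr hw⟩⟩⟩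

end AdjunctionSystem

/-! ### The inclusion-exclusion formula -/

/-- Sorting the nonempty subsets of `Fin n` by their least element and by their size. -/
theorem sum_least_element_eq {n : ℕ} (J : Finset (Fin n) → ℝ) :
    ∑ k : Fin n, ∑ u ∈ (Finset.univ.filter fun j => k < j).powerset,
        (-1 : ℝ) ^ u.card * J (insert k u) =
      ∑ i, J {i} - ∑ p ∈ Finset.Icc 2 n, (-1 : ℝ) ^ p *
        ∑ s ∈ Finset.powersetCard p (Finset.univ : Finset (Fin n)), J s := by
  have h1 : ∑ k : Fin n, ∑ u ∈ (Finset.univ.filter fun j => k < j).powerset,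
      (-1 : ℝ) ^ u.card * J (insert k u) =
      ∑ s ∈ (Finset.univ : Finset (Fin n)).powerset with s.Nonempty,
        (-1 : ℝ) ^ (s.card + 1) * J s := by
    rw [Finset.sum_sigma']
    refine Finset.sum_bij' (fun p _ => insert p.1 p.2)
      (fun s hs => ⟨s.min' (Finset.mem_filter.1 hs).2, s.erase (s.min' (Finset.mem_filter.1 hs).2)⟩)
      ?_ ?_ ?_ ?_ ?_
    · intro p _
      simp
    · intro s hs
      simp only [Finset.mem_sigma, Finset.mem_univ, Finset.mem_powerset, true_and]
      intro j hj
      rw [Finset.mem_erase] at hj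
      simpa using lt_of_le_of_ne (s.min'_le j hj.2) hj.1.symm
    · rintro ⟨k, u⟩ hp
      have hu : ∀ j ∈ u, k < j := fun j hj => by
        simpa using Finset.mem_powerset.1 (Finset.mem_sigma.1 hp).2 hj
      have hmin : ∀ h, (insert k u).min' h = k := fun h =>
        le_antisymm (Finset.min'_le _ _ (Finset.mem_insert_self _ _)) (Finset.le_min' _ _ _ (by
          intro j hj
          rcases Finset.mem_insert.1 hj with rfl | hj
          · exact le_rfl
          · exact (hu j hj).le))
      have hk : k ∉ u := fun h => lt_irrefl _ (hu k h)
      simp only [hmin, Finset.erase_insert hk]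
    · intro s hs
      exact Finset.insert_erase (s.min'_mem (Finset.mem_filter.1 hs).2)
    · rintro ⟨k, u⟩ hp
      have hk : k ∉ u := fun h => by
        simpa using Finset.mem_powerset.1 (Finset.mem_sigma.1 hp).2 h
      change (-1 : ℝ) ^ u.card * J (insert k u) = (-1 : ℝ) ^ ((insert k u).card + 1) * _
      rw [Finset.card_insert_of_notMem hk, pow_succ, pow_succ]
      ring
  have h2 : ∑ s ∈ (Finset.univ : Finset (Fin n)).powerset with s.Nonempty,
      (-1 : ℝ) ^ (s.card + 1) * J s =
      ∑ p ∈ Finset.Icc 1 n, ∑ s ∈ Finset.powersetCard p (Finset.univ : Finset (Fin n)),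
        (-1 : ℝ) ^ (p + 1) * J s := by
    rw [← Finset.sum_fiberwise_of_maps_to (t := Finset.Icc 1 n) (g := Finset.card)]
    · refine Finset.sum_congr rfl fun p hp => ?_
      have hp1 := (Finset.mem_Icc.1 hp).1
      refine Finset.sum_congr ?_ ?_
      · ext s
        simp only [Finset.powerset_univ, Finset.mem_filter, Finset.mem_univ, true_and,
          Finset.mem_powersetCard_univ, and_iff_right_iff_imp]
        intro h
        rw [← Finset.card_pos]
        omega
      · intro s hs
        rw [Finset.mem_powersetCard_univ.1 hs]
    · intro s hs
      rw [Finset.mem_Icc]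
      exact ⟨Finset.card_pos.2 (Finset.mem_filter.1 hs).2, by simpa using Finset.card_le_univ s⟩
  rw [h1, h2]
  rcases n with _ | m
  · simp
  · rw [← Finset.add_sum_Ioc_eq_sum_Icc (by omega : 1 ≤ m + 1), sub_eq_add_neg,
      ← Finset.sum_neg_distrib]
    congr 1
    · simp [Finset.powersetCard_one]
    · refine Finset.sum_congr rfl fun p _ => ?_
      rw [← Finset.mul_sum, pow_succ]
      ring

section WellDefined

variable {d : ℕ} {X : Type*} [TopologicalSpace X] [ChartedSpace (Euc d) X]

theorem formIntegral_eq_of_forall_value_eq {𝒪 : Set (OpenPartialHomeomorph X (Euc d))}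
    {K : Set X} {η : TopForm d X} {v : ℝ} (hne : Nonempty (Parametrisation 𝒪 K η))
    (h : ∀ P : Parametrisation 𝒪 K η, P.value = v) :
    IntegralWellDefined 𝒪 K η ∧ formIntegral 𝒪 K η = v := by
  have h1 : formIntegral 𝒪 K η = v := by
    rw [formIntegral, dif_pos hne]
    exact h _
  exact ⟨⟨hne, fun P => (h P).trans h1.symm⟩, h1⟩

end WellDefined

namespace AdjunctionSystem

variable {d n : ℕ} {M : Fin n → Type*} [∀ i, TopologicalSpace (M i)]
    [∀ i, ChartedSpace (Euc d) (M i)] {G : AdjunctionSystem d n M}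

theorem integralClosure_eq {𝒪 : ∀ i, Set (OpenPartialHomeomorph (M i) (Euc d))}
    {η : TopForm d G.Colimit} {s : Finset (Fin n)} {k : Fin n} (hk : k ∈ s)
    (hle : ∀ j ∈ s, k ≤ j) :
    G.integralClosure 𝒪 η s =
      formIntegral (𝒪 k) (G.closureIn s k) (TopForm.pullback (G.φ k) η) := by
  have hs : s.Nonempty := ⟨k, hk⟩
  have hmin : s.min' hs = k := le_antisymm (s.min'_le k hk) (s.le_min' hs k hle)
  rw [integralClosure, dif_pos hs]
  clear hle
  subst hmin
  rfl

variable [∀ i, IsManifold 𝓘(ℝ, Euc d) ∞ (M i)] [∀ i, T2Space (M i)]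
  {𝒪 : ∀ i, Set (OpenPartialHomeomorph (M i) (Euc d))} {η : TopForm d G.Colimit}

/-- The integral over the closure of an intersection exists, and only the intersection of the
closures matters. -/
theorem formIntegral_closureIn (B : ∀ k, BallCover (𝒪 k) (G.φ k ⁻¹' η.supportOn univ))
    (hG : ∀ i j, IsRegularDomain d (closure (G.U i j)))
    (h𝒪 : ∀ i, IsOrientedAtlas (𝒪 i)) (hη : η.IsContinuous) (s : Finset (Fin n)) (i : Fin n) :
    IntegralWellDefined (𝒪 i) (G.closureIn s i) (TopForm.pullback (G.φ i) η) ∧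
    formIntegral (𝒪 i) (G.closureIn s i) (TopForm.pullback (G.φ i) η) =
      (B i).integral (TopForm.pullback (G.φ i) η) (⋂ j ∈ s, closure (G.U i j)) := by
  have hsupp : ∀ x, TopForm.pullback (G.φ i) η x ≠ 0 → x ∈ G.φ i ⁻¹' η.supportOn univ := by
    intro x hx
    refine subset_closure ⟨mem_univ _, fun h0 => hx ?_⟩
    rw [TopForm.pullback, h0]
    rfl
  have hK : IsClosed (G.closureIn s i) := isClosed_closure
  have hsub : G.closureIn s i ⊆ ⋂ j ∈ s, closure (G.U i j) := by
    rw [closureIn_eq]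
    exact closure_minimal (iInter₂_mono fun _ _ => subset_closure)
      (isClosed_biInter fun _ _ => isClosed_closure)
  have hnull := isNullSet_biInter_closure_diff hG s i
  have hfr : IsNullSet d (frontier (interior (G.closureIn s i))) := by
    refine hnull.mono (frontier_interior_subset.trans ?_)
    rw [hK.frontier_eq]
    exact sdiff_subset_sdiff_left hsub
  have hdense : G.closureIn s i ⊆ closure (interior (G.closureIn s i)) := by
    rw [closureIn_eq]
    refine closure_mono (interior_maximal subset_closure ?_)
    exact s.finite_toSet.isOpen_biInter fun j _ => G.isOpen_U i j
  rw [← (B i).integral_congr_null (h𝒪 i) _ hsub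
    (hnull.mono (sdiff_subset_sdiff_right interior_subset))]
  refine formIntegral_eq_of_forall_value_eq ?_ fun P => ?_
  · exact (B i).nonempty_parametrisation (h𝒪 i) isOpen_interior hfr interior_subset hdense hsupp
  · exact (B i).value_eq_integral (h𝒪 i) (hη.pullback (G.contMDiff_φ i)) hsupp
      (by rw [← isOpen_compl_iff] at hK
          exact (MeasurableSpace.measurableSet_generateFrom hK).of_compl) P

end AdjunctionSystem

theorem mainTheorem6 {d n : ℕ} {M : Fin n → Type*} [∀ i, TopologicalSpace (M i)]
    [∀ i, ChartedSpace (Euc d) (M i)] [∀ i, IsManifold 𝓘(ℝ, Euc d) ∞ (M i)]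
    [∀ i, T2Space (M i)] [∀ i, SecondCountableTopology (M i)]
    (G : AdjunctionSystem d n M) (hG : G.HasDiffeomorphicBoundaries)
    (𝒪 : ∀ i, Set (OpenPartialHomeomorph (M i) (Euc d))) (h𝒪 : ∀ i, IsOrientedAtlas (𝒪 i))
    (hf : ∀ i j, PreservesOrientationOn (𝒪 i) (𝒪 j) (G.f i j) (G.U i j))
    (η : TopForm d G.Colimit) (hη : η.IsSmooth) (hc : IsCompact (η.supportOn univ)) :
    -- all integrals below exist and do not depend on the chosen parametrisation
    IntegralWellDefined (G.orientation 𝒪) univ η ∧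
    (∀ i, IntegralWellDefined (𝒪 i) univ (TopForm.pullback (G.φ i) η)) ∧
    (∀ (s : Finset (Fin n)), ∀ i ∈ s,
      IntegralWellDefined (𝒪 i) (G.closureIn s i) (TopForm.pullback (G.φ i) η)) ∧
    -- the general formula
    formIntegral (G.orientation 𝒪) univ η =
      (∑ i, formIntegral (𝒪 i) univ (TopForm.pullback (G.φ i) η)) -
      ∑ p ∈ Finset.Icc 2 n, (-1 : ℝ) ^ p *
        ∑ s ∈ Finset.powersetCard p (Finset.univ : Finset (Fin n)), G.integralClosure 𝒪 η s ∧
    -- the binary case, in which `i` and `j` are the only indices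
    (∀ i j : Fin n, i ≠ j → (∀ k, k = i ∨ k = j) →
      formIntegral (G.orientation 𝒪) univ η =
        formIntegral (𝒪 i) univ (TopForm.pullback (G.φ i) η) +
        formIntegral (𝒪 j) univ (TopForm.pullback (G.φ j) η) -
        formIntegral (𝒪 i) (closure (G.U i j)) (TopForm.pullback (G.φ i) η)) := by
  obtain ⟨hreg, F, hF1, hF2, hF3, hF4, hF5⟩ := hG
  have hF : G.IsClosureGluing F := ⟨hF1, hF2, hF3, hF4, hF5⟩
  have hηc := hη.isContinuous
  have B : ∀ k, BallCover (𝒪 k) (G.φ k ⁻¹' η.supportOn univ) := fun k =>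
    Classical.choice (BallCover.nonempty_of_isCompact (h𝒪 k)
      (hF.isCompact_preimage_φ hc isClosed_closure k))
  have hI := AdjunctionSystem.formIntegral_closureIn B hreg h𝒪 hηc
  have huniv : ∀ i, G.closureIn ∅ i = univ := fun i => by
    simp [AdjunctionSystem.closureIn, AdjunctionSystem.inter]
  -- the integral over the colimit, for an arbitrary ranking of the `M k`
  have hM : ∀ σ : Fin n → ℕ, Function.Injective σ →
      IntegralWellDefined (G.orientation 𝒪) univ η ∧ formIntegral (G.orientation 𝒪) univ η =
        ∑ k, ∑ u ∈ (Finset.univ.filter fun j => σ k < σ j).powerset, (-1 : ℝ) ^ u.card *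
          formIntegral (𝒪 k) (G.closureIn u k) (TopForm.pullback (G.φ k) η) := by
    intro σ hσ
    have h1 := formIntegral_eq_of_forall_value_eq
      (AdjunctionSystem.nonempty_parametrisation B hreg h𝒪 hf hηc hσ)
      (hF.value_eq_sum_integral B h𝒪 hηc hσ)
    refine ⟨h1.1, h1.2.trans (Finset.sum_congr rfl fun k _ => ?_)⟩
    rw [AdjunctionSystem.region, (B k).integral_compl_biUnion (h𝒪 k)
      (hηc.pullback (G.contMDiff_φ k)) _ fun j => ?_]
    · exact Finset.sum_congr rfl fun u _ => by rw [(hI u k).2]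
    · exact (MeasurableSpace.measurableSet_generateFrom
        (isClosed_closure (s := G.U k j)).isOpen_compl).of_compl
  have hinsert : ∀ (u : Finset (Fin n)) k, G.closureIn (insert k u) k = G.closureIn u k := by
    intro u k
    rw [AdjunctionSystem.closureIn_eq, AdjunctionSystem.closureIn_eq, Finset.set_biInter_insert,
      G.U_self, univ_inter]
  refine ⟨(hM _ Fin.val_injective).1, fun i => huniv i ▸ (hI ∅ i).1, fun s i _ => (hI s i).1,
    ?_, ?_⟩
  · rw [(hM _ Fin.val_injective).2]
    have h1 : ∀ i, formIntegral (𝒪 i) univ (TopForm.pullback (G.φ i) η) =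
        G.integralClosure 𝒪 η {i} := by
      intro i
      rw [AdjunctionSystem.integralClosure_eq (Finset.mem_singleton_self i) (by simp),
        ← huniv i, ← hinsert ∅ i]
      rfl
    simp_rw [h1]
    rw [← sum_least_element_eq]
    refine Finset.sum_congr rfl fun k _ => Finset.sum_congr rfl fun u hu => ?_
    rw [AdjunctionSystem.integralClosure_eq (Finset.mem_insert_self k u), hinsert]
    intro j hj
    rcases Finset.mem_insert.1 hj with rfl | hj
    · exact le_rfl
    · have := Finset.mem_powerset.1 hu hj
      simp only [Finset.mem_filter] at this
      exact this.2.le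
  · intro i j hij hk
    -- rank `i` below `j`
    have hσ : Function.Injective fun k : Fin n => if k = i then 0 else 1 := by
      intro k l hkl
      rcases hk k with rfl | rfl <;> rcases hk l with rfl | rfl <;> simp_all
    have huv : (Finset.univ : Finset (Fin n)) = {i, j} := by
      ext k
      simpa using hk k
    rw [(hM _ hσ).2, huv, Finset.sum_pair hij]
    have hfi : (({i, j} : Finset (Fin n)).filter fun l =>
        (if i = i then 0 else 1) < (if l = i then 0 else 1)) = {j} := by
      ext l
      rcases hk l with rfl | rfl <;> simp [hij, hij.symm]
    have hfj : (({i, j} : Finset (Fin n)).filter fun l =>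
        (if j = i then 0 else 1) < (if l = i then 0 else 1)) = ∅ := by
      ext l
      rcases hk l with rfl | rfl <;> simp [hij.symm]
    have hcl : G.closureIn {j} i = closure (G.U i j) := by
      rw [AdjunctionSystem.closureIn_eq]
      simp
    have hpow : ({j} : Finset (Fin n)).powerset = {∅, {j}} := by
      ext u
      simp [Finset.subset_singleton_iff]
    rw [hfi, hfj, hpow, Finset.sum_pair (by simp), Finset.powerset_empty, Finset.sum_singleton,
      huniv, huniv, hcl]
    simp
    ring
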